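/- Let $\mathbf E_1^3$ be $\mathbb R^3$ with the metric $\langle\,,\rangle=dx_1^2+dx_2^2-dx_3^2$. Let $\Omega\subset\mathbb R^2$ be a nonempty connected open set and let $X=X(u,v):\Omega\to\mathbf E_1^3$ be a $C^\infty$ non-degenerate (spacelike or timelike) surface of zero mean curvature (ZMC) which is intrinsic rotational, that is, its first fundamental form is $\rho(u)^2(\delta\,du^2+\epsilon\,dv^2)$ with $\rho>0$ and $\delta,\epsilon\in\{1,-1\}$. Assume that $X$ has constant twist $\alpha=c\in\mathbb R$: there are functions $\lambda_1(u),\lambda_2(u)$ such that the matrix of the Weingarten endomorphism in the basis $X_u,X_v$ is $R_{-c}\,\mathrm{diag}(\lambda_1,\lambda_2)\,R_c$ if the surface is spacelike, and $G_{-c}\,\mathrm{diag}(\lambda_1,\lambda_2)\,G_c$ if it is timelike, where $R_c=\begin{pmatrix}\cos c&-\sin c\\ \sin c&\cos c\end{pmatrix}$ and $G_c=\begin{pmatrix}\cosh c&\sinh c\\ \sinh c&\cosh c\end{pmatrix}$. Assume that no nonempty open subset of $\Omega$ consists of umbilic points. Then $X$ is an associate surface of a ZMC surface of revolution $Y:\Omega\to\mathbf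 E_1^3$ (with timelike, spacelike or lightlike axis). That is, for some $\theta\in\mathbb R$: in the spacelike case $Y$ is conformal and spacelike and $X=\cos\theta\,Y+\sin\theta\,Y^*$, where $Y+iY^*$ is holomorphic ($Y_u=Y^*_v$, $Y_v=-Y^*_u$); in the timelike case $Y$ is paraconformal and timelike and $X=\cosh\theta\,Y+\sinh\theta\,Y^*$, where $Y+\tau Y^*$, $\tau^2=1$, is paraholomorphic ($Y_u=Y^*_v$, $Y_v=Y^*_u$). Moreover, up to a rigid motion and a homothety of $\mathbf E_1^3$ and a change of parameters $w=ku+d$, $t=kv$ with $k>0$, $d\in\mathbb R$, the surface $Y$ is a piece of one of the following catenoids. 1. Spacelike case: the elliptic catenoid $(\sinh w\cos t,\ \sinh w\sin t,\ w)$, or the parabolic catenoid $\left(\tfrac{w^3}3+w(1-t^2),\ -2wt,\ \tfrac{w^3}3-w(1+t^2)\right)$, or the hyperbolic catenoid $(w,\ \sin w\sinh t,\ \sin w\cosh t)$; their axes are timelike, lightlike and spacelike, respectively. 2. Timelike case with $\delta=1=-\epsilon$: the timelike catenoid $(w,\ \cosh w\cosh t,\ \cosh w\sinh t)$. 3. Timelike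 case with $\delta=-1=-\epsilon$: $(w,\ \sinh w\sinh t,\ \sinh w\cosh t)$, or $\left(-\tfrac{w^3}3+w(1-t^2),\ -2wt,\ -\tfrac{w^3}3-w(1+t^2)\right)$, or $(\sin w\cos t,\ \sin w\sin t,\ w)$. -/

import Mathlib

open scoped ContDiff Matrix

namespace Minkowski3

noncomputable section

/-- The underlying vector space of the Lorentz-Minkowski space. -/
abbrev E := Fin 3 → ℝ

/-- The Lorentzian metric `dx₁² + dx₂² - dx₃²`. -/
def lip (x y : E) : ℝ := x 0 * y 0 + x 1 * y 1 - x 2 * y 2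

/-- The Lorentzian cross product, `lip (cross x y) z = det (x, y, z)`. -/
def cross (x y : E) : E :=
  ![x 1 * y 2 - x 2 * y 1, x 2 * y 0 - x 0 * y 2, -(x 0 * y 1 - x 1 * y 0)]

/-- A rigid motion: a Lorentzian linear isometry followed by a translation. -/
def IsRigidMotion (Φ : E → E) : Prop :=
  ∃ (M : Matrix (Fin 3) (Fin 3) ℝ) (q : E),
    (∀ x y : E, lip (M *ᵥ x) (M *ᵥ y) = lip x y) ∧ ∀ x : E, Φ x = M *ᵥ x + q

/-! Local theory of a surface parametrized by `X : ℝ × ℝ → E`, coordinates `(u, v)`. -/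

/-- The partial derivative `X_u`. -/
def du (X : ℝ × ℝ → E) (p : ℝ × ℝ) : E := fderiv ℝ X p (1, 0)

/-- The partial derivative `X_v`. -/
def dv (X : ℝ × ℝ → E) (p : ℝ × ℝ) : E := fderiv ℝ X p (0, 1)

/-- The matrix of the first fundamental form in the basis `X_u, X_v`. -/
def firstForm (X : ℝ × ℝ → E) (p : ℝ × ℝ) : Matrix (Fin 2) (Fin 2) ℝ :=
  !![lip (du X p) (du X p), lip (du X p) (dv X p);
     lip (dv X p) (du X p), lip (dv X p) (dv X p)]

/-- The unit normal `N`, the normalized cross product of `X_u` and `X_v`. -/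
def unitNormal (X : ℝ × ℝ → E) (p : ℝ × ℝ) : E :=
  (Real.sqrt |lip (cross (du X p) (dv X p)) (cross (du X p) (dv X p))|)⁻¹ •
    cross (du X p) (dv X p)

/-- The matrix of the second fundamental form, with entries `⟨X_uu, N⟩` and so on. -/
def secondForm (X : ℝ × ℝ → E) (p : ℝ × ℝ) : Matrix (Fin 2) (Fin 2) ℝ :=
  !![lip (du (du X) p) (unitNormal X p), lip (dv (du X) p) (unitNormal X p);
     lip (du (dv X) p) (unitNormal X p), lip (dv (dv X) p) (unitNormal X p)]

/-- The matrix `A = I⁻¹ II` of the Weingarten endomorphism in the basis `X_u, X_v`. -/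
def weingarten (X : ℝ × ℝ → E) (p : ℝ × ℝ) : Matrix (Fin 2) (Fin 2) ℝ :=
  (firstForm X p)⁻¹ * secondForm X p

/-- The mean curvature `H = -σ tr(A) / 2`, where `σ`, the sign of `det I`, is `1` for spacelike
and `-1` for timelike surfaces. -/
def meanCurvature (X : ℝ × ℝ → E) (p : ℝ × ℝ) : ℝ :=
  -Real.sign (firstForm X p).det * (weingarten X p).trace / 2

/-- A point is umbilic if the Weingarten endomorphism is a multiple of the identity. -/
def IsUmbilic (X : ℝ × ℝ → E) (p : ℝ × ℝ) : Prop :=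
  ∃ l : ℝ, weingarten X p = l • (1 : Matrix (Fin 2) (Fin 2) ℝ)

/-- The umbilic points contain no nonempty open set. -/
def NoOpenUmbilicSet (X : ℝ × ℝ → E) (Ω : Set (ℝ × ℝ)) : Prop :=
  ∀ W : Set (ℝ × ℝ), IsOpen W → W ⊆ Ω → W.Nonempty → ∃ p ∈ W, ¬ IsUmbilic X p

/-- A smooth nondegenerate surface (which is then an immersion) parametrized over `Ω`. -/
def IsSurface (X : ℝ × ℝ → E) (Ω : Set (ℝ × ℝ)) : Prop :=
  ContDiffOn ℝ ∞ X Ω ∧ ∀ p ∈ Ω, (firstForm X p).det ≠ 0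

/-- The induced metric is Riemannian. -/
def IsSpacelike (X : ℝ × ℝ → E) (Ω : Set (ℝ × ℝ)) : Prop :=
  ∀ p ∈ Ω, (firstForm X p).PosDef

/-- The induced metric is Lorentzian. -/
def IsTimelike (X : ℝ × ℝ → E) (Ω : Set (ℝ × ℝ)) : Prop :=
  ∀ p ∈ Ω, (firstForm X p).det < 0

/-- A surface of zero mean curvature. -/
def IsZMCSurface (X : ℝ × ℝ → E) (Ω : Set (ℝ × ℝ)) : Prop :=
  IsSurface X Ω ∧ ∀ p ∈ Ω, meanCurvature X p = 0

/-- Intrinsic rotational: the first fundamental form is `ρ(u)² (δ du² + ε dv²)`, with `δ` and `ε`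
equal to `1` or `-1`. -/
def IsIntrinsicRotational (X : ℝ × ℝ → E) (Ω : Set (ℝ × ℝ)) (δ ε : ℝ) : Prop :=
  (δ = 1 ∨ δ = -1) ∧ (ε = 1 ∨ ε = -1) ∧
    ∃ ρ : ℝ → ℝ, ∀ p ∈ Ω, 0 < ρ p.1 ∧ firstForm X p = ρ p.1 ^ 2 • !![δ, 0; 0, ε]

/-- The Euclidean rotation `R_a` of the plane. -/
def R (a : ℝ) : Matrix (Fin 2) (Fin 2) ℝ :=
  !![Real.cos a, -Real.sin a; Real.sin a, Real.cos a]

/-- The hyperbolic rotation `G_a` of the plane. -/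
def G (a : ℝ) : Matrix (Fin 2) (Fin 2) ℝ :=
  !![Real.cosh a, Real.sinh a; Real.sinh a, Real.cosh a]

/-- Twist `α`: the principal curvatures depend only on `u`, and the principal frame is turned by
`α(v)` against the coordinate frame. -/
def HasTwist (X : ℝ × ℝ → E) (Ω : Set (ℝ × ℝ)) (α : ℝ → ℝ) : Prop :=
  ContDiff ℝ ∞ α ∧ ∃ l₁ l₂ : ℝ → ℝ,
    (IsSpacelike X Ω ∧ ∀ p ∈ Ω,
      weingarten X p = R (-α p.2) * !![l₁ p.1, 0; 0, l₂ p.1] * R (α p.2)) ∨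
    (IsTimelike X Ω ∧ ∀ p ∈ Ω,
      weingarten X p = G (-α p.2) * !![l₁ p.1, 0; 0, l₂ p.1] * G (α p.2))

/-! Associate surfaces. -/

/-- `X` is the associate surface `cos θ Y + sin θ Y*` of the conformal spacelike ZMC surface `Y`,
where `Y + i Y*` is holomorphic (the Cauchy-Riemann equations). -/
def IsSpacelikeAssociate (X Y : ℝ × ℝ → E) (Ω : Set (ℝ × ℝ)) (θ : ℝ) : Prop :=
  IsZMCSurface Y Ω ∧ IsSpacelike Y Ω ∧
  (∀ p ∈ Ω, ∃ m : ℝ, firstForm Y p = m • !![1, 0; 0, 1]) ∧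
  ∃ Ystar : ℝ × ℝ → E, ContDiffOn ℝ ∞ Ystar Ω ∧
    (∀ p ∈ Ω, du Y p = dv Ystar p ∧ dv Y p = -du Ystar p) ∧
    ∀ p ∈ Ω, X p = Real.cos θ • Y p + Real.sin θ • Ystar p

/-- `X` is the associate surface `cosh θ Y + sinh θ Y*` of the paraconformal timelike ZMC surface
`Y`, where `Y + τ Y*`, `τ² = 1`, is paraholomorphic. -/
def IsTimelikeAssociate (X Y : ℝ × ℝ → E) (Ω : Set (ℝ × ℝ)) (θ : ℝ) : Prop :=
  IsZMCSurface Y Ω ∧ IsTimelike Y Ω ∧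
  (∀ p ∈ Ω, ∃ m : ℝ, firstForm Y p = m • !![1, 0; 0, -1]) ∧
  ∃ Ystar : ℝ × ℝ → E, ContDiffOn ℝ ∞ Ystar Ω ∧
    (∀ p ∈ Ω, du Y p = dv Ystar p ∧ dv Y p = du Ystar p) ∧
    ∀ p ∈ Ω, X p = Real.cosh θ • Y p + Real.sinh θ • Ystar p

/-! Surfaces of revolution. -/

/-- Rotations about the timelike `x₃`-axis. -/
def rotTimelike (t : ℝ) : Matrix (Fin 3) (Fin 3) ℝ :=
  !![Real.cos t, -Real.sin t, 0; Real.sin t, Real.cos t, 0; 0, 0, 1]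

/-- Rotations about the spacelike `x₁`-axis. -/
def rotSpacelike (t : ℝ) : Matrix (Fin 3) (Fin 3) ℝ :=
  !![1, 0, 0; 0, Real.cosh t, Real.sinh t; 0, Real.sinh t, Real.cosh t]

/-- Rotations about the lightlike axis spanned by `(1, 0, 1)`. -/
def rotLightlike (t : ℝ) : Matrix (Fin 3) (Fin 3) ℝ :=
  !![1 - t ^ 2 / 2, t, t ^ 2 / 2; -t, 1, t; -(t ^ 2 / 2), t, 1 + t ^ 2 / 2]

/-- `Y` parametrizes a piece of a surface of revolution: after a rigid motion, its points are
obtained by rotating a smooth profile curve `γ` about an axis that is timelike, spacelike or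
lightlike. -/
def IsSurfaceOfRevolution (Y : ℝ × ℝ → E) (Ω : Set (ℝ × ℝ)) : Prop :=
  ∃ Φ : E → E, IsRigidMotion Φ ∧
  ∃ rot : ℝ → Matrix (Fin 3) (Fin 3) ℝ,
    (rot = rotTimelike ∨ rot = rotSpacelike ∨ rot = rotLightlike) ∧
  ∃ (J : Set ℝ) (γ : ℝ → E) (s t : ℝ × ℝ → ℝ),
    IsOpen J ∧ ContDiffOn ℝ ∞ γ J ∧ Set.MapsTo s Ω J ∧
    ContDiffOn ℝ ∞ s Ω ∧ ContDiffOn ℝ ∞ t Ω ∧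
    ∀ p ∈ Ω, Y p = Φ (rot (t p) *ᵥ γ (s p))

/-- `Y` is, up to a rigid motion, a homothety of ratio `r` and a change of the parameters to
`(k u + d, k v)`, a piece of the parametrized surface `C`. -/
def IsSimilarPiece (Y : ℝ × ℝ → E) (Ω : Set (ℝ × ℝ)) (C : ℝ × ℝ → E) : Prop :=
  ∃ Φ : E → E, IsRigidMotion Φ ∧ ∃ r k d : ℝ, 0 < r ∧ 0 < k ∧
    ∀ p ∈ Ω, Y p = Φ (r • C (k * p.1 + d, k * p.2))

/-- The (spacelike) elliptic catenoid `x₁² + x₂² = sinh² x₃`. -/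
def ellipticCatenoid (p : ℝ × ℝ) : E :=
  ![Real.sinh p.1 * Real.cos p.2, Real.sinh p.1 * Real.sin p.2, p.1]

/-- The spacelike hyperbolic catenoid, in `x₃² - x₂² = sin² x₁`. -/
def hyperbolicCatenoid (p : ℝ × ℝ) : E :=
  ![p.1, Real.sin p.1 * Real.sinh p.2, Real.sin p.1 * Real.cosh p.2]

/-- The spacelike parabolic catenoid, with lightlike axis. -/
def parabolicCatenoid (p : ℝ × ℝ) : E :=
  ![p.1 ^ 3 / 3 + p.1 * (1 - p.2 ^ 2), -2 * p.2 * p.1, p.1 ^ 3 / 3 - p.1 * (1 + p.2 ^ 2)]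

/-- The timelike catenoid, in `x₂² - x₃² = cosh² x₁`. -/
def timelikeCatenoid (p : ℝ × ℝ) : E :=
  ![p.1, Real.cosh p.1 * Real.cosh p.2, Real.cosh p.1 * Real.sinh p.2]

/-- The timelike surface in `x₃² - x₂² = sinh² x₁`, with spacelike axis. -/
def timelikeHyperbolicCatenoid (p : ℝ × ℝ) : E :=
  ![p.1, Real.sinh p.1 * Real.sinh p.2, Real.sinh p.1 * Real.cosh p.2]

/-- The timelike surface `x₁² + x₂² = sin² x₃`, with timelike axis. -/
def timelikeEllipticCatenoid (p : ℝ × ℝ) : E :=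
  ![Real.sin p.1 * Real.cos p.2, Real.sin p.1 * Real.sin p.2, p.1]

/-- The timelike parabolic catenoid, with lightlike axis. -/
def timelikeParabolicCatenoid (p : ℝ × ℝ) : E :=
  ![-(p.1 ^ 3 / 3) + p.1 * (1 - p.2 ^ 2), -2 * p.2 * p.1,
    -(p.1 ^ 3 / 3) - p.1 * (1 + p.2 ^ 2)]

end

end Minkowski3

/-! Both causal characters are treated at once through a sign `η = ⟨N, N⟩`, which is `-1` for
spacelike and `1` for timelike surfaces. The metric is then `P² (δ du² - η δ dv²)` with `P = ρ(u)`.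
Zero mean curvature and constant twist `c` give a second fundamental form `μ(u) (α du² + 2 β du dv +
η α dv²)`, where `(α, β)` is the point with parameter `±2c` on the conic `α² - η β² = 1`:
conjugating `diag(l, -l)` by a rotation doubles the angle.

The Codazzi equations make this form constant (`gauss_codazzi`), so `μ = m`, and `m ≠ 0` because
some point is not umbilic. The Gauss equation becomes `P'' P - P'² = η δ m²`, with first integral
`P'² = -η δ m² + C P²` (`exists_first_integral`). Hence `P'' = C P`. If `-η δ = 1`, the sign of `C`
selects `sinh`, the identity or `sin` (`hasProfile_of_elliptic`); if `-η δ = -1`, then `C > 0` and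
only `cosh` occurs (`hasProfile_cosh`). These are exactly the conformal factors of the listed
catenoids.

Turning the frame of the matching catenoid by `(α, β)` gives the frame of an associate surface with
the same first and second fundamental forms as `X` (`IsFrame.rotate`). Frames with equal structure
equations differ by a fixed isometry (`IsFrame.exists_isometry`), so `X` is an associate of a moved
catenoid (`exists_associate`). Every integration is the vanishing of a derivative on the connected
set `Ω`. -/

namespace Minkowski3

/-! ### Calculus of partial derivatives in the plane. -/

/-- The function `f` of two real variables is differentiable at `p`, with partial derivatives
`a` and `b`. -/
def HasPD {F : Type*} [NormedAddCommGroup F] [NormedSpace ℝ F]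
    (f : ℝ × ℝ → F) (a b : F) (p : ℝ × ℝ) : Prop :=
  HasFDerivAt f ((ContinuousLinearMap.fst ℝ ℝ ℝ).smulRight a +
    (ContinuousLinearMap.snd ℝ ℝ ℝ).smulRight b) p

namespace HasPD

section General

variable {F : Type*} [NormedAddCommGroup F] [NormedSpace ℝ F]
  {f g : ℝ × ℝ → F} {a b a' b' : F} {p : ℝ × ℝ}

theorem of_hasFDerivAt {L : ℝ × ℝ →L[ℝ] F} (h : HasFDerivAt f L p) :
    HasPD f (L (1, 0)) (L (0, 1)) p := by
  refine h.congr_fderiv ?_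
  ext <;> simp

theorem fderiv_left (h : HasPD f a b p) : fderiv ℝ f p (1, 0) = a := by
  rw [HasFDerivAt.fderiv h]; simp

theorem fderiv_right (h : HasPD f a b p) : fderiv ℝ f p (0, 1) = b := by
  rw [HasFDerivAt.fderiv h]; simp

theorem unique (h : HasPD f a b p) (h' : HasPD f a' b' p) : a = a' ∧ b = b' :=
  ⟨h.fderiv_left.symm.trans h'.fderiv_left, h.fderiv_right.symm.trans h'.fderiv_right⟩

theorem congr_values (h : HasPD f a b p) (ha : a = a') (hb : b = b') : HasPD f a' b' p := by
  subst ha hb; exact h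

theorem congr_on {Ω : Set (ℝ × ℝ)} (h : HasPD f a b p) (hΩ : IsOpen Ω) (hp : p ∈ Ω)
    (hfg : ∀ q ∈ Ω, g q = f q) : HasPD g a b p :=
  HasFDerivAt.congr_of_eventuallyEq h (Filter.eventually_of_mem (hΩ.mem_nhds hp) hfg)

theorem const (c : F) (p : ℝ × ℝ) : HasPD (fun _ => c) 0 0 p := by
  refine (hasFDerivAt_const c p).congr_fderiv ?_
  ext <;> simp

theorem add (hf : HasPD f a b p) (hg : HasPD g a' b' p) :
    HasPD (fun q => f q + g q) (a + a') (b + b') p := by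
  refine (HasFDerivAt.add hf hg).congr_fderiv ?_
  ext <;> simp

theorem sub (hf : HasPD f a b p) (hg : HasPD g a' b' p) :
    HasPD (fun q => f q - g q) (a - a') (b - b') p := by
  refine (HasFDerivAt.sub hf hg).congr_fderiv ?_
  ext <;> simp

theorem smul {r : ℝ × ℝ → ℝ} {s t : ℝ} (hr : HasPD r s t p) (hf : HasPD f a b p) :
    HasPD (fun q => r q • f q) (r p • a + s • f p) (r p • b + t • f p) p := by
  refine (HasFDerivAt.fun_smul hr hf).congr_fderiv ?_
  ext <;> simp

theorem const_smul (c : ℝ) (hf : HasPD f a b p) :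
    HasPD (fun q => c • f q) (c • a) (c • b) p := by
  refine (HasFDerivAt.fun_const_smul hf c).congr_fderiv ?_
  ext <;> simp

theorem clm {G : Type*} [NormedAddCommGroup G] [NormedSpace ℝ G] (L : F →L[ℝ] G)
    (hf : HasPD f a b p) : HasPD (fun q => L (f q)) (L a) (L b) p := by
  refine (L.hasFDerivAt.comp p hf).congr_fderiv ?_
  ext <;> simp

theorem comp_affine {k d : ℝ} (h : HasPD f a b (k * p.1 + d, k * p.2)) :
    HasPD (fun q => f (k * q.1 + d, k * q.2)) (k • a) (k • b) p := by
  have h1 : HasFDerivAt (fun q : ℝ × ℝ => (k * q.1 + d, k * q.2))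
      ((k • ContinuousLinearMap.fst ℝ ℝ ℝ).prod (k • ContinuousLinearMap.snd ℝ ℝ ℝ)) p :=
    ((hasFDerivAt_fst.const_mul k).add_const d).prodMk (hasFDerivAt_snd.const_mul k)
  refine (HasFDerivAt.comp (g := f) (f := fun q : ℝ × ℝ => (k * q.1 + d, k * q.2)) p h
    h1).congr_fderiv ?_
  ext <;> simp

theorem comp_fst {φ : ℝ → F} (h : HasDerivAt φ a p.1) : HasPD (fun q => φ q.1) a 0 p := by
  refine (h.hasFDerivAt.comp p hasFDerivAt_fst).congr_fderiv ?_
  ext <;> simp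

/-- A function that only depends on the first variable has vanishing second partial. -/
theorem right_eq_zero {Ω : Set (ℝ × ℝ)} (h : HasPD f a b p) (hΩ : IsOpen Ω) (hp : p ∈ Ω)
    {φ : ℝ → F} (hφ : ∀ q ∈ Ω, f q = φ q.1) : b = 0 := by
  -- `φ` carries no regularity. The function `φ q.1` is literally constant on the whole vertical
  -- line through `p`, so its derivative along that line is zero.
  have h1 : HasPD (fun q : ℝ × ℝ => φ q.1) a b p := h.congr_on hΩ hp fun q hq => (hφ q hq).symm
  have h2 : HasDerivAt (fun t : ℝ => (p.1, t)) ((0 : ℝ), (1 : ℝ)) p.2 :=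
    (hasDerivAt_const _ _).prodMk (hasDerivAt_id _)
  have h3 := HasFDerivAt.comp_hasDerivAt (l := fun q : ℝ × ℝ => φ q.1)
    (f := fun t : ℝ => (p.1, t)) p.2 h1 h2
  have h4 := h3.unique (hasDerivAt_const p.2 (φ p.1))
  simpa using h4

/-- This replaces all uniqueness theorems for differential equations below. Functions of `u` are
also treated on `Ω`, whose vertical slices may be disconnected. -/
theorem exists_const {Ω : Set (ℝ × ℝ)} (hΩ : IsOpen Ω) (hc : IsConnected Ω)
    (h : ∀ p ∈ Ω, HasPD f 0 0 p) : ∃ c, ∀ p ∈ Ω, f p = c := by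
  refine hΩ.exists_is_const_of_fderiv_eq_zero hc.isPreconnected
    (fun p hp => (HasFDerivAt.differentiableAt (h p hp)).differentiableWithinAt) fun p hp => ?_
  rw [HasFDerivAt.fderiv (h p hp)]
  ext <;> simp

end General

section Components

variable {p : ℝ × ℝ}

theorem mul {f g : ℝ × ℝ → ℝ} {a b a' b' : ℝ} (hf : HasPD f a b p) (hg : HasPD g a' b' p) :
    HasPD (fun q => f q * g q) (f p * a' + a * g p) (f p * b' + b * g p) p := hf.smul hg

theorem inv {f : ℝ × ℝ → ℝ} {a b : ℝ} (hf : HasPD f a b p) (h0 : f p ≠ 0) :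
    HasPD (fun q => (f q)⁻¹) (-a / f p ^ 2) (-b / f p ^ 2) p := by
  refine ((hasDerivAt_inv h0).comp_hasFDerivAt p hf).congr_fderiv ?_
  ext <;> simp <;> ring

theorem apply {f : ℝ × ℝ → E} {a b : E} (h : HasPD f a b p) (i : Fin 3) :
    HasPD (fun q => f q i) (a i) (b i) p :=
  h.clm (ContinuousLinearMap.proj (R := ℝ) (φ := fun _ : Fin 3 => ℝ) i)

theorem vec {f g h : ℝ × ℝ → ℝ} {a b c a' b' c' : ℝ}
    (hf : HasPD f a a' p) (hg : HasPD g b b' p) (hh : HasPD h c c' p) :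
    HasPD (fun q => (![f q, g q, h q] : E)) ![a, b, c] ![a', b', c'] p := by
  refine hasFDerivAt_pi'.2 fun i => ?_
  fin_cases i
  · refine HasFDerivAt.congr_fderiv hf ?_
    ext <;> simp
  · refine HasFDerivAt.congr_fderiv hg ?_
    ext <;> simp
  · refine HasFDerivAt.congr_fderiv hh ?_
    ext <;> simp

theorem lip {f g : ℝ × ℝ → E} {a b a' b' : E} (hf : HasPD f a b p) (hg : HasPD g a' b' p) :
    HasPD (fun q => lip (f q) (g q)) (lip (f p) a' + lip a (g p))
      (lip (f p) b' + lip b (g p)) p := by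
  refine ((((hf.apply 0).mul (hg.apply 0)).add ((hf.apply 1).mul (hg.apply 1))).sub
    ((hf.apply 2).mul (hg.apply 2))).congr_values ?_ ?_ <;>
  · simp only [Minkowski3.lip]; ring

theorem mulVec (M : Matrix (Fin 3) (Fin 3) ℝ) {f : ℝ × ℝ → E} {a b : E} (h : HasPD f a b p) :
    HasPD (fun q => M *ᵥ f q) (M *ᵥ a) (M *ᵥ b) p :=
  h.clm (LinearMap.toContinuousLinearMap M.mulVecLin)

end Components

end HasPD

/-! ### Smoothness and symmetry of second derivatives. -/

section Partials

variable {F : Type*} [NormedAddCommGroup F] [NormedSpace ℝ F] {f : ℝ × ℝ → F} {Ω : Set (ℝ × ℝ)}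

theorem contDiffOn_fderiv_apply (hf : ContDiffOn ℝ ∞ f Ω) (hΩ : IsOpen Ω) (w : ℝ × ℝ) :
    ContDiffOn ℝ ∞ (fun p => fderiv ℝ f p w) Ω :=
  (hf.fderiv_of_isOpen hΩ (by simp)).clm_apply contDiffOn_const

theorem hasPD_of_contDiffOn (hf : ContDiffOn ℝ ∞ f Ω) (hΩ : IsOpen Ω) {p : ℝ × ℝ} (hp : p ∈ Ω) :
    HasPD f (fderiv ℝ f p (1, 0)) (fderiv ℝ f p (0, 1)) p :=
  .of_hasFDerivAt
    ((hf.differentiableOn (by simp)).differentiableAt (hΩ.mem_nhds hp)).hasFDerivAt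

/-- Smooth functions have smooth partial derivatives. -/
theorem exists_partials (hf : ContDiffOn ℝ ∞ f Ω) (hΩ : IsOpen Ω) :
    ∃ a b : ℝ × ℝ → F, ContDiffOn ℝ ∞ a Ω ∧ ContDiffOn ℝ ∞ b Ω ∧
      ∀ p ∈ Ω, HasPD f (a p) (b p) p :=
  ⟨_, _, contDiffOn_fderiv_apply hf hΩ _, contDiffOn_fderiv_apply hf hΩ _,
    fun _ hp => hasPD_of_contDiffOn hf hΩ hp⟩

/-- Mixed second partial derivatives agree. -/
theorem mixed_partials {a b : ℝ × ℝ → F} {a₁ a₂ b₁ b₂ : F} {p : ℝ × ℝ} (hΩ : IsOpen Ω)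
    (hp : p ∈ Ω) (hf : ∀ q ∈ Ω, HasPD f (a q) (b q) q) (ha : HasPD a a₁ a₂ p)
    (hb : HasPD b b₁ b₂ p) : a₂ = b₁ := by
  -- `S` and `T` make the total derivative a continuous linear function of the two partials, so its
  -- own derivative follows from those of `a` and `b`.
  let S : F →L[ℝ] (ℝ × ℝ →L[ℝ] F) :=
    ContinuousLinearMap.smulRightL ℝ (ℝ × ℝ) F (ContinuousLinearMap.fst ℝ ℝ ℝ)
  let T : F →L[ℝ] (ℝ × ℝ →L[ℝ] F) :=
    ContinuousLinearMap.smulRightL ℝ (ℝ × ℝ) F (ContinuousLinearMap.snd ℝ ℝ ℝ)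
  have h2 : HasPD (fun q => S (a q) + T (b q)) (S a₁ + T b₁) (S a₂ + T b₂) p :=
    (ha.clm S).add (hb.clm T)
  have h1 : ∀ᶠ q in nhds p, HasFDerivAt f (S (a q) + T (b q)) q :=
    Filter.eventually_of_mem (hΩ.mem_nhds hp) hf
  have h3 := second_derivative_symmetric_of_eventually h1 h2 (1, 0) (0, 1)
  simpa [S, T] using h3.symm

end Partials

/-! ### Lorentzian linear algebra. -/

section Algebra

theorem lip_comm (x y : E) : lip x y = lip y x := by simp only [lip]; ring

theorem lip_add_left (x y z : E) : lip (x + y) z = lip x z + lip y z := by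
  simp only [lip, Pi.add_apply]; ring

theorem lip_add_right (x y z : E) : lip x (y + z) = lip x y + lip x z := by
  simp only [lip, Pi.add_apply]; ring

theorem lip_sub_left (x y z : E) : lip (x - y) z = lip x z - lip y z := by
  simp only [lip, Pi.sub_apply]; ring

theorem lip_sub_right (x y z : E) : lip x (y - z) = lip x y - lip x z := by
  simp only [lip, Pi.sub_apply]; ring

theorem lip_neg_left (x y : E) : lip (-x) y = -lip x y := by
  simp only [lip, Pi.neg_apply]; ring

theorem lip_neg_right (x y : E) : lip x (-y) = -lip x y := by
  simp only [lip, Pi.neg_apply]; ring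

theorem lip_smul_left (r : ℝ) (x y : E) : lip (r • x) y = r * lip x y := by
  simp only [lip, Pi.smul_apply, smul_eq_mul]; ring

theorem lip_smul_right (r : ℝ) (x y : E) : lip x (r • y) = r * lip x y := by
  simp only [lip, Pi.smul_apply, smul_eq_mul]; ring

theorem lip_cross_self_left (x y : E) : lip (cross x y) x = 0 := by
  simp only [lip, cross, Matrix.cons_val]; ring

theorem lip_cross_self_right (x y : E) : lip (cross x y) y = 0 := by
  simp only [lip, cross, Matrix.cons_val]; ring

theorem lip_cross_cross (x y : E) :
    lip (cross x y) (cross x y) = lip x y ^ 2 - lip x x * lip y y := by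
  simp only [lip, cross, Matrix.cons_val]; ring

/-- Expansion of a vector in an orthogonal frame. -/
theorem orthogonal_expansion {δ ε η P : ℝ} (hδ : δ * δ = 1) (hε : ε * ε = 1) (hη : η * η = 1)
    (hP : P ≠ 0) {U V n : E} (hUU : lip U U = δ * P ^ 2) (hVV : lip V V = ε * P ^ 2)
    (hnn : lip n n = η * P ^ 2) (hUV : lip U V = 0) (hUn : lip U n = 0) (hVn : lip V n = 0)
    (x : E) :
    x = (P⁻¹) ^ 2 • ((δ * lip x U) • U + (ε * lip x V) • V + (η * lip x n) • n) := by
  let A : Matrix (Fin 3) (Fin 3) ℝ := !![U 0, V 0, n 0; U 1, V 1, n 1; U 2, V 2, n 2]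
  let B : Matrix (Fin 3) (Fin 3) ℝ := P⁻¹ ^ 2 •
    !![δ * U 0, δ * U 1, -(δ * U 2); ε * V 0, ε * V 1, -(ε * V 2);
       η * n 0, η * n 1, -(η * n 2)]
  simp only [lip] at hUU hVV hnn hUV hUn hVn
  -- Orthogonality says that `B` is a left inverse of the frame matrix `A`. For square matrices it
  -- is also a right inverse, and `A B x = x` is the expansion.
  have hBA : B * A = 1 := by
    ext i j
    fin_cases i <;> fin_cases j <;>
      simp [A, B, Matrix.mul_apply, Fin.sum_univ_three] <;> field_simp
    · linear_combination δ * hUU + P ^ 2 * hδ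
    · linear_combination δ * hUV
    · linear_combination δ * hUn
    · linear_combination ε * hUV
    · linear_combination ε * hVV + P ^ 2 * hε
    · linear_combination ε * hVn
    · linear_combination η * hUn
    · linear_combination η * hVn
    · linear_combination η * hnn + P ^ 2 * hη
  have hAB : A * B = 1 := mul_eq_one_comm.1 hBA
  have h : A *ᵥ (B *ᵥ x) = x := by rw [Matrix.mulVec_mulVec, hAB, Matrix.one_mulVec]
  rw [← h]
  conv_rhs => rw [h]
  ext i
  fin_cases i <;>
    simp [A, B, Matrix.mulVec, dotProduct, Fin.sum_univ_three, lip] <;> ring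

end Algebra

/-! ### Frames, their rigidity, rotation and scaling. -/

/-- The structure equations of a surface with first fundamental form `P² (δ du² - η δ dv²)`,
second fundamental form `e du² + 2 f du dv + η e dv²` with constant `e` and `f`, coordinate
vector fields `U`, `V` and unit normal `P⁻¹ n`, where `P` depends on `u` only and has the
derivative `Q`. -/
structure IsFrame (η δ e f : ℝ) (P Q : ℝ × ℝ → ℝ) (U V n : ℝ × ℝ → E) (Ω : Set (ℝ × ℝ)) :
    Prop where
  ne_zero : ∀ p ∈ Ω, P p ≠ 0
  lip_UU : ∀ p ∈ Ω, lip (U p) (U p) = δ * P p ^ 2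
  lip_VV : ∀ p ∈ Ω, lip (V p) (V p) = -(η * δ) * P p ^ 2
  lip_nn : ∀ p ∈ Ω, lip (n p) (n p) = η * P p ^ 2
  lip_UV : ∀ p ∈ Ω, lip (U p) (V p) = 0
  lip_Un : ∀ p ∈ Ω, lip (U p) (n p) = 0
  lip_Vn : ∀ p ∈ Ω, lip (V p) (n p) = 0
  hasPD_P : ∀ p ∈ Ω, HasPD P (Q p) 0 p
  hasPD_U : ∀ p ∈ Ω, HasPD U ((P p)⁻¹ • (Q p • U p + (η * e) • n p))
    ((P p)⁻¹ • (Q p • V p + (η * f) • n p)) p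
  hasPD_V : ∀ p ∈ Ω, HasPD V ((P p)⁻¹ • (Q p • V p + (η * f) • n p))
    ((P p)⁻¹ • ((η * Q p) • U p + e • n p)) p
  hasPD_n : ∀ p ∈ Ω, HasPD n ((P p)⁻¹ • (Q p • n p - δ • (e • U p - (η * f) • V p)))
    ((P p)⁻¹ • (-(δ • (f • U p - e • V p)))) p

namespace IsFrame

variable {η δ e f : ℝ} {P Q : ℝ × ℝ → ℝ} {U V n U' V' n' : ℝ × ℝ → E} {Ω : Set (ℝ × ℝ)}

theorem expansion (hη : η = 1 ∨ η = -1) (hδ : δ = 1 ∨ δ = -1) (h : IsFrame η δ e f P Q U V n Ω)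
    {p : ℝ × ℝ} (hp : p ∈ Ω) (x : E) :
    x = ((P p)⁻¹) ^ 2 • ((δ * lip x (U p)) • U p + (-(η * δ) * lip x (V p)) • V p +
      (η * lip x (n p)) • n p) := by
  refine orthogonal_expansion ?_ ?_ ?_ (h.ne_zero p hp) (h.lip_UU p hp) (h.lip_VV p hp)
    (h.lip_nn p hp) (h.lip_UV p hp) (h.lip_Un p hp) (h.lip_Vn p hp) x <;>
  · rcases hη with rfl | rfl <;> rcases hδ with rfl | rfl <;> norm_num

/-- Two frames with the same data differ by a linear isometry. -/
theorem exists_isometry (hη : η = 1 ∨ η = -1) (hδ : δ = 1 ∨ δ = -1) (hΩ : IsOpen Ω)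
    (hc : IsConnected Ω) (h : IsFrame η δ e f P Q U V n Ω)
    (h' : IsFrame η δ e f P Q U' V' n' Ω) :
    ∃ M : Matrix (Fin 3) (Fin 3) ℝ, (∀ x y, lip (M *ᵥ x) (M *ᵥ y) = lip x y) ∧
      ∀ p ∈ Ω, M *ᵥ U' p = U p ∧ M *ᵥ V' p = V p := by
  -- At each `p` this is the linear map carrying the primed frame to the unprimed one. Since both
  -- frames solve the same linear system, its derivative in `p` cancels.
  let L : E → ℝ × ℝ → E := fun x p => ((P p)⁻¹ * (P p)⁻¹) • ((δ * lip x (U' p)) • U p +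
    (-(η * δ) * lip x (V' p)) • V p + (η * lip x (n' p)) • n p)
  have hL : ∀ x, ∀ p ∈ Ω, HasPD (L x) 0 0 p := by
    intro x p hp
    have c : ∀ {w : ℝ × ℝ → E} {a b : E} (s : ℝ), HasPD w a b p →
        HasPD (fun q => s * lip x (w q)) (s * lip x a) (s * lip x b) p := by
      intro w a b s hw
      refine (((HasPD.const x p).lip hw).const_smul s).congr_values ?_ ?_ <;> simp [lip]
    have hi := (h.hasPD_P p hp).inv (h.ne_zero p hp)
    refine ((hi.mul hi).smul (((((c δ (h'.hasPD_U p hp)).smul (h.hasPD_U p hp)).add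
      ((c (-(η * δ)) (h'.hasPD_V p hp)).smul (h.hasPD_V p hp))).add
      ((c η (h'.hasPD_n p hp)).smul (h.hasPD_n p hp))))).congr_values ?_ ?_ <;>
    simp only [lip_smul_right, lip_add_right, lip_sub_right, lip_neg_right, div_eq_mul_inv,
      neg_zero, zero_mul, mul_zero, add_zero, zero_smul, ← inv_pow] <;>
    rcases hη with rfl | rfl <;> module
  choose! g hg using fun x => HasPD.exists_const hΩ hc (hL x)
  obtain ⟨p₀, hp₀⟩ := hc.nonempty
  let M : E →ₗ[ℝ] E :=
    { toFun := fun x => L x p₀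
      map_add' := fun x y => by simp only [L, lip_add_left]; module
      map_smul' := fun r x => by simp only [L, lip_smul_left, RingHom.id_apply]; module }
  have hM : ∀ x, ∀ p ∈ Ω, LinearMap.toMatrix' M *ᵥ x = L x p := fun x p hp => by
    rw [LinearMap.toMatrix'_mulVec]
    exact (hg x p₀ hp₀).trans (hg x p hp).symm
  refine ⟨LinearMap.toMatrix' M, fun x y => ?_, fun p hp => ⟨?_, ?_⟩⟩
  · rw [hM x p₀ hp₀, hM y p₀ hp₀]
    have h0 := h.ne_zero p₀ hp₀
    conv_rhs => rw [h'.expansion hη hδ hp₀ x]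
    simp only [L, lip_smul_left, lip_smul_right, lip_add_left, lip_add_right, h.lip_UU p₀ hp₀,
      h.lip_VV p₀ hp₀, h.lip_nn p₀ hp₀, h.lip_UV p₀ hp₀, h.lip_Un p₀ hp₀, h.lip_Vn p₀ hp₀,
      lip_comm (V p₀) (U p₀), lip_comm (n p₀) (U p₀), lip_comm (n p₀) (V p₀),
      lip_comm (U' p₀) y, lip_comm (V' p₀) y, lip_comm (n' p₀) y]
    field_simp
    rcases hη with rfl | rfl <;> rcases hδ with rfl | rfl <;> ring
  · rw [hM _ p hp]
    simp only [L, h'.lip_UU p hp, h'.lip_UV p hp, h'.lip_Un p hp]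
    have h0 : (P p)⁻¹ * P p = 1 := inv_mul_cancel₀ (h.ne_zero p hp)
    have : δ * δ = 1 := by rcases hδ with rfl | rfl <;> norm_num
    linear_combination (norm := module) (δ * δ * ((P p)⁻¹ * P p + 1) * h0 + this) • (U p)
  · rw [hM _ p hp]
    simp only [L, h'.lip_VV p hp, lip_comm (V' p) (U' p), h'.lip_UV p hp, h'.lip_Vn p hp]
    have h0 : (P p)⁻¹ * P p = 1 := inv_mul_cancel₀ (h.ne_zero p hp)
    have : (η * δ) * (η * δ) = 1 := by
      rcases hη with rfl | rfl <;> rcases hδ with rfl | rfl <;> norm_num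
    linear_combination (norm := module)
      ((η * δ) * (η * δ) * ((P p)⁻¹ * P p + 1) * h0 + this) • (V p)

/-- The frame of an associate surface. -/
theorem rotate {α β m : ℝ} (hαβ : α ^ 2 - η * β ^ 2 = 1) (hη : η = 1 ∨ η = -1)
    (h : IsFrame η δ m 0 P Q U V n Ω) :
    IsFrame η δ (m * α) (m * β) P Q (fun p => α • U p + (η * β) • V p)
      (fun p => α • V p + β • U p) n Ω := by
  have hη2 : η ^ 2 = 1 := by rcases hη with rfl | rfl <;> norm_num
  refine ⟨h.ne_zero, ?_, ?_, h.lip_nn, ?_, ?_, ?_, h.hasPD_P, ?_, ?_, ?_⟩ <;> intro p hp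
  all_goals have hU := h.hasPD_U p hp
  all_goals have hV := h.hasPD_V p hp
  all_goals have hn := h.hasPD_n p hp
  · simp only [lip_smul_left, lip_smul_right, lip_add_left, lip_add_right, h.lip_UU p hp,
      h.lip_VV p hp, lip_comm (V p) (U p), h.lip_UV p hp]
    linear_combination δ * P p ^ 2 * hαβ - η * δ * β ^ 2 * P p ^ 2 * hη2
  · simp only [lip_smul_left, lip_smul_right, lip_add_left, lip_add_right, h.lip_UU p hp,
      h.lip_VV p hp, lip_comm (V p) (U p), h.lip_UV p hp]
    linear_combination -η * δ * P p ^ 2 * hαβ - δ * β ^ 2 * P p ^ 2 * hη2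
  · simp only [lip_smul_left, lip_smul_right, lip_add_left, lip_add_right, h.lip_UU p hp,
      h.lip_VV p hp, lip_comm (V p) (U p), h.lip_UV p hp]
    linear_combination -α * β * δ * P p ^ 2 * hη2
  · simp only [lip_smul_left, lip_add_left, h.lip_Un p hp, h.lip_Vn p hp]; ring
  · simp only [lip_smul_left, lip_add_left, h.lip_Un p hp, h.lip_Vn p hp]; ring
  · refine ((hU.const_smul α).add (hV.const_smul (η * β))).congr_values ?_ ?_ <;>
      rcases hη with rfl | rfl <;> module
  · refine ((hV.const_smul α).add (hU.const_smul β)).congr_values ?_ ?_ <;>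
      rcases hη with rfl | rfl <;> module
  · refine hn.congr_values ?_ ?_
    -- For the turned fields `U'`, `V'`, the combination `α U' - η β V'` equals `(α² - η β²) U = U`;
    -- the next line likewise uses `β U' - α V' = -V`.
    · linear_combination (norm := module) ((P p)⁻¹ * (δ * m) * hαβ) • (U p)
    · linear_combination (norm := module) (-(P p)⁻¹ * (δ * m) * hαβ) • (V p)

/-- The frame after a homothety and a change of parameters. -/
theorem scale {h₀ h₁ : ℝ × ℝ → ℝ} {Ω₀ : Set (ℝ × ℝ)} {m r k d s s' : ℝ}
    (h : IsFrame η δ 1 0 h₀ h₁ U V n Ω₀)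
    (hmap : ∀ p ∈ Ω, (k * p.1 + d, k * p.2) ∈ Ω₀) (hs : s ≠ 0) (h₁s : s ^ 2 = (r * k) ^ 2)
    (h₂s : s' ^ 2 = (r * k) ^ 2) (hm : m * s' = s * r * k ^ 2) (hm' : s * s' = m * r) :
    IsFrame η δ m 0 (fun p => s * h₀ (k * p.1 + d, k * p.2))
      (fun p => s * (k * h₁ (k * p.1 + d, k * p.2)))
      (fun p => (r * k) • U (k * p.1 + d, k * p.2))
      (fun p => (r * k) • V (k * p.1 + d, k * p.2))
      (fun p => s' • n (k * p.1 + d, k * p.2)) Ω := by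
  -- The fields scale by `r k`. Only the squares of `s` and `s'` are tied to it, so their signs
  -- remain free to match the signs of `P` and `m`.
  refine ⟨fun p hp => mul_ne_zero hs (h.ne_zero _ (hmap p hp)), ?_, ?_, ?_, ?_, ?_, ?_, ?_, ?_,
    ?_, ?_⟩ <;> intro p hp <;> have hp' := hmap p hp <;> have h0 := h.ne_zero _ hp'
  · simp only [lip_smul_left, lip_smul_right, h.lip_UU _ hp']
    linear_combination -δ * h₀ (k * p.1 + d, k * p.2) ^ 2 * h₁s
  · simp only [lip_smul_left, lip_smul_right, h.lip_VV _ hp']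
    linear_combination η * δ * h₀ (k * p.1 + d, k * p.2) ^ 2 * h₁s
  · simp only [lip_smul_left, lip_smul_right, h.lip_nn _ hp']
    linear_combination η * h₀ (k * p.1 + d, k * p.2) ^ 2 * (h₂s - h₁s)
  · simp only [lip_smul_left, lip_smul_right, h.lip_UV _ hp', mul_zero]
  · simp only [lip_smul_left, lip_smul_right, h.lip_Un _ hp', mul_zero]
  · simp only [lip_smul_left, lip_smul_right, h.lip_Vn _ hp', mul_zero]
  · exact ((h.hasPD_P _ hp').comp_affine.const_smul s).congr_values rfl (by simp)
  · refine ((h.hasPD_U _ hp').comp_affine.const_smul (r * k)).congr_values ?_ ?_ <;>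
      match_scalars <;> field_simp
    · linear_combination -η * hm
    · ring
  · refine ((h.hasPD_V _ hp').comp_affine.const_smul (r * k)).congr_values ?_ ?_ <;>
      match_scalars <;> field_simp
    · ring
    · linear_combination -hm
  · refine ((h.hasPD_n _ hp').comp_affine.const_smul s').congr_values ?_ ?_ <;>
      match_scalars <;> field_simp
    · linear_combination -k * δ * hm'
    · ring
    · ring
    · linear_combination k * δ * hm'

end IsFrame

/-! ### The differential equation of the conformal factor. -/

section ConformalFactor

variable {P Q : ℝ × ℝ → ℝ} {Ω : Set (ℝ × ℝ)} {m C : ℝ}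

/-- The quotient `(Q² - κ) / P²` has derivative `2 Q (Q₁ P - Q² + κ) / P³ = 0`. Substituting the
first integral back into the Gauss equation linearizes it. -/
theorem exists_first_integral {κ : ℝ} (hΩ : IsOpen Ω) (hc : IsConnected Ω)
    (hP0 : ∀ p ∈ Ω, P p ≠ 0) (hP : ∀ p ∈ Ω, HasPD P (Q p) 0 p) {Q₁ : ℝ × ℝ → ℝ}
    (hQ : ∀ p ∈ Ω, HasPD Q (Q₁ p) 0 p)
    (h : ∀ p ∈ Ω, Q₁ p * P p - Q p ^ 2 = -κ) :
    ∃ C, (∀ p ∈ Ω, HasPD Q (C * P p) 0 p) ∧ ∀ p ∈ Ω, Q p ^ 2 = κ + C * P p ^ 2 := by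
  obtain ⟨C, hC⟩ := HasPD.exists_const (f := fun p => (Q p * Q p - κ) * ((P p)⁻¹ * (P p)⁻¹))
    hΩ hc fun p hp => by
      have hi := (hP p hp).inv (hP0 p hp)
      refine ((((hQ p hp).mul (hQ p hp)).sub (HasPD.const κ p)).mul (hi.mul hi)).congr_values
        ?_ ?_
      · have := hP0 p hp
        field_simp
        linear_combination 2 * Q p * h p hp
      · simp
  have hC' : ∀ p ∈ Ω, Q p ^ 2 = κ + C * P p ^ 2 := fun p hp => by
    have := hP0 p hp
    rw [← hC p hp]
    field_simp
    ring
  refine ⟨C, fun p hp => (hQ p hp).congr_values ?_ rfl, hC'⟩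
  have := hP0 p hp
  field_simp
  refine mul_right_cancel₀ this ?_
  linear_combination h p hp + hC' p hp

/-- The coefficients are recovered by inverting the fundamental matrix: `P cosh - k⁻¹ Q sinh` and
`k⁻¹ Q cosh - P sinh` have zero derivative. -/
theorem solution_hyperbolic {k : ℝ} (hk : k ≠ 0) (hΩ : IsOpen Ω) (hc : IsConnected Ω)
    (hP : ∀ p ∈ Ω, HasPD P (Q p) 0 p) (hQ : ∀ p ∈ Ω, HasPD Q (k ^ 2 * P p) 0 p) :
    ∃ a b, (∀ p ∈ Ω, P p = a * Real.cosh (k * p.1) + b * Real.sinh (k * p.1)) ∧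
      ∀ p ∈ Ω, Q p = k * (a * Real.sinh (k * p.1) + b * Real.cosh (k * p.1)) := by
  have hch : ∀ p : ℝ × ℝ, HasPD (fun q : ℝ × ℝ => Real.cosh (k * q.1)) (k * Real.sinh (k * p.1))
      0 p := fun p => HasPD.comp_fst (φ := fun x => Real.cosh (k * x))
    (by simpa [mul_comm] using ((hasDerivAt_id p.1).const_mul k).cosh)
  have hsh : ∀ p : ℝ × ℝ, HasPD (fun q : ℝ × ℝ => Real.sinh (k * q.1)) (k * Real.cosh (k * p.1))
      0 p := fun p => HasPD.comp_fst (φ := fun x => Real.sinh (k * x))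
    (by simpa [mul_comm] using ((hasDerivAt_id p.1).const_mul k).sinh)
  obtain ⟨a, ha⟩ := HasPD.exists_const
    (f := fun p => P p * Real.cosh (k * p.1) - (k⁻¹ * Q p) * Real.sinh (k * p.1))
    hΩ hc fun p hp => by
      refine (((hP p hp).mul (hch p)).sub
        (((hQ p hp).const_smul k⁻¹).mul (hsh p))).congr_values ?_ (by simp)
      simp only [smul_eq_mul]; field_simp; ring
  obtain ⟨b, hb⟩ := HasPD.exists_const
    (f := fun p => (k⁻¹ * Q p) * Real.cosh (k * p.1) - P p * Real.sinh (k * p.1))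
    hΩ hc fun p hp => by
      refine ((((hQ p hp).const_smul k⁻¹).mul (hch p)).sub
        ((hP p hp).mul (hsh p))).congr_values ?_ (by simp)
      simp only [smul_eq_mul]; field_simp; ring
  refine ⟨a, b, fun p hp => ?_, fun p hp => ?_⟩ <;> rw [← ha p hp, ← hb p hp]
  · linear_combination -P p * Real.cosh_sq_sub_sinh_sq (k * p.1)
  · field_simp
    linear_combination -Q p * Real.cosh_sq_sub_sinh_sq (k * p.1)

theorem solution_trigonometric {k : ℝ} (hk : k ≠ 0) (hΩ : IsOpen Ω) (hc : IsConnected Ω)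
    (hP : ∀ p ∈ Ω, HasPD P (Q p) 0 p) (hQ : ∀ p ∈ Ω, HasPD Q (-k ^ 2 * P p) 0 p) :
    ∃ a b, (∀ p ∈ Ω, P p = a * Real.cos (k * p.1) + b * Real.sin (k * p.1)) ∧
      ∀ p ∈ Ω, Q p = k * (b * Real.cos (k * p.1) - a * Real.sin (k * p.1)) := by
  have hch : ∀ p : ℝ × ℝ, HasPD (fun q : ℝ × ℝ => Real.cos (k * q.1)) (-k * Real.sin (k * p.1))
      0 p := fun p => HasPD.comp_fst (φ := fun x => Real.cos (k * x))
    (by simpa [mul_comm] using ((hasDerivAt_id p.1).const_mul k).cos)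
  have hsh : ∀ p : ℝ × ℝ, HasPD (fun q : ℝ × ℝ => Real.sin (k * q.1)) (k * Real.cos (k * p.1))
      0 p := fun p => HasPD.comp_fst (φ := fun x => Real.sin (k * x))
    (by simpa [mul_comm] using ((hasDerivAt_id p.1).const_mul k).sin)
  obtain ⟨a, ha⟩ := HasPD.exists_const
    (f := fun p => P p * Real.cos (k * p.1) - (k⁻¹ * Q p) * Real.sin (k * p.1))
    hΩ hc fun p hp => by
      refine (((hP p hp).mul (hch p)).sub
        (((hQ p hp).const_smul k⁻¹).mul (hsh p))).congr_values ?_ (by simp)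
      simp only [smul_eq_mul]; field_simp; ring
  obtain ⟨b, hb⟩ := HasPD.exists_const
    (f := fun p => (k⁻¹ * Q p) * Real.cos (k * p.1) + P p * Real.sin (k * p.1))
    hΩ hc fun p hp => by
      refine ((((hQ p hp).const_smul k⁻¹).mul (hch p)).add
        ((hP p hp).mul (hsh p))).congr_values ?_ (by simp)
      simp only [smul_eq_mul]; field_simp; ring
  refine ⟨a, b, fun p hp => ?_, fun p hp => ?_⟩ <;> rw [← ha p hp, ← hb p hp]
  · linear_combination -P p * Real.sin_sq_add_cos_sq (k * p.1)
  · field_simp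
    linear_combination -Q p * Real.sin_sq_add_cos_sq (k * p.1)

/-- A conformal factor with the profile `h`, up to scaling and an affine change of parameter. -/
def HasProfile (P : ℝ × ℝ → ℝ) (m : ℝ) (h : ℝ → ℝ) (Ω : Set (ℝ × ℝ)) : Prop :=
  ∃ σ k d : ℝ, (σ = 1 ∨ σ = -1) ∧ 0 < k ∧ ∀ p ∈ Ω, P p = σ * (|m| / k) * h (k * p.1 + d)

theorem exists_sign (b : ℝ) : ∃ σ : ℝ, (σ = 1 ∨ σ = -1) ∧ σ * b = |b| := by
  rcases abs_choice b with h | h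
  · exact ⟨1, .inl rfl, by rw [h, one_mul]⟩
  · exact ⟨-1, .inr rfl, by rw [h]; ring⟩

/-- Polar coordinates on a hyperbola. -/
theorem exists_hyperbolic_angle {a b r : ℝ} (hr : 0 < r) (h : b ^ 2 - a ^ 2 = r ^ 2) :
    ∃ σ d : ℝ, (σ = 1 ∨ σ = -1) ∧ σ * r * Real.sinh d = a ∧ σ * r * Real.cosh d = b := by
  obtain ⟨σ, hσ, hb⟩ := exists_sign b
  have hσ2 : σ * σ = 1 := by rcases hσ with rfl | rfl <;> norm_num
  refine ⟨σ, Real.arsinh (σ * a / r), hσ, ?_, ?_⟩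
  · rw [Real.sinh_arsinh]
    field_simp
    linear_combination a * hσ2
  · rw [Real.cosh_arsinh]
    have : 1 + (σ * a / r) ^ 2 = (|b| / r) ^ 2 := by
      rw [← hb]
      field_simp
      linear_combination -h + (b ^ 2 - a ^ 2) * -hσ2
    rw [this, Real.sqrt_sq (by positivity), ← hb]
    field_simp
    linear_combination b * hσ2

theorem exists_trigonometric_angle {a b r : ℝ} (hr : 0 < r) (h : b ^ 2 + a ^ 2 = r ^ 2) :
    ∃ d : ℝ, r * Real.sin d = a ∧ r * Real.cos d = b := by
  have hn : ‖(⟨b, a⟩ : ℂ)‖ = r := by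
    rw [Complex.norm_def, Complex.normSq_mk, ← sq, ← sq, h, Real.sqrt_sq hr.le]
  refine ⟨Complex.arg ⟨b, a⟩, ?_, ?_⟩
  · rw [← hn]; exact Complex.norm_mul_sin_arg ⟨b, a⟩
  · rw [← hn]; exact Complex.norm_mul_cos_arg ⟨b, a⟩

/-- The first integral fixes the quadratic invariant of the coefficients at `(m / k)²`. Polar
coordinates on the circle or hyperbola then turn the general solution into a shifted `sin` or
`sinh`; for `C = 0` the solution is affine with slope `±m`. -/
theorem hasProfile_of_elliptic (hm : m ≠ 0) (hΩ : IsOpen Ω) (hc : IsConnected Ω)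
    (hP : ∀ p ∈ Ω, HasPD P (Q p) 0 p) (hQ : ∀ p ∈ Ω, HasPD Q (C * P p) 0 p)
    (h : ∀ p ∈ Ω, Q p ^ 2 = m ^ 2 + C * P p ^ 2) :
    HasProfile P m Real.sinh Ω ∨ HasProfile P m id Ω ∨ HasProfile P m Real.sin Ω := by
  have hm' : 0 < |m| := abs_pos.2 hm
  obtain ⟨p₀, hp₀⟩ := hc.nonempty
  rcases lt_trichotomy C 0 with hC | rfl | hC
  · obtain ⟨k, hk, rfl⟩ : ∃ k : ℝ, 0 < k ∧ C = -k ^ 2 :=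
      ⟨√(-C), Real.sqrt_pos.2 (by linarith), by rw [Real.sq_sqrt (by linarith)]; ring⟩
    obtain ⟨a, b, hab, hab'⟩ := solution_trigonometric hk.ne' hΩ hc hP hQ
    obtain ⟨d, rfl, rfl⟩ := exists_trigonometric_angle (a := a) (b := b) (r := |m| / k)
      (by positivity) (by
        have h0 := h p₀ hp₀
        rw [hab p₀ hp₀, hab' p₀ hp₀] at h0
        rw [div_pow, sq_abs]
        field_simp
        linear_combination h0 - (b ^ 2 + a ^ 2) * k ^ 2 * Real.sin_sq_add_cos_sq (k * p₀.1))
    -- No sign is needed here, since the angle `d` runs over the full circle.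
    refine .inr (.inr ⟨1, k, d, .inl rfl, hk, fun p hp => ?_⟩)
    rw [hab p hp, Real.sin_add]; ring
  · obtain ⟨q, hq⟩ := HasPD.exists_const hΩ hc fun p hp =>
      (hQ p hp).congr_values (zero_mul _) rfl
    have hq2 : q ^ 2 = m ^ 2 := by rw [← hq p₀ hp₀, h p₀ hp₀]; ring
    have hq0 : q ≠ 0 := fun h0 => hm (by simpa [h0] using hq2.symm)
    obtain ⟨a, ha⟩ := HasPD.exists_const (f := fun p => P p - q * p.1) hΩ hc fun p hp =>
      ((hP p hp).sub ((HasPD.comp_fst (φ := id) (hasDerivAt_id p.1)).const_smul q)).congr_values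
        (by simp [hq p hp]) (by simp)
    obtain ⟨σ, hσ, hσq⟩ := exists_sign q
    have hσ2 : σ * σ = 1 := by rcases hσ with rfl | rfl <;> norm_num
    refine .inr (.inl ⟨σ, 1, a / q, hσ, one_pos, fun p hp => ?_⟩)
    rw [← (sq_eq_sq_iff_abs_eq_abs q m).1 hq2, ← hσq, ← ha p hp]
    simp only [id]
    field_simp
    linear_combination -P p * hσ2
  · obtain ⟨k, hk, rfl⟩ : ∃ k : ℝ, 0 < k ∧ C = k ^ 2 :=
      ⟨√C, Real.sqrt_pos.2 hC, by rw [Real.sq_sqrt hC.le]⟩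
    obtain ⟨a, b, hab, hab'⟩ := solution_hyperbolic hk.ne' hΩ hc hP hQ
    obtain ⟨σ, d, hσ, rfl, rfl⟩ := exists_hyperbolic_angle (a := a) (b := b) (r := |m| / k)
      (by positivity) (by
        have h0 := h p₀ hp₀
        rw [hab p₀ hp₀, hab' p₀ hp₀] at h0
        rw [div_pow, sq_abs]
        field_simp
        linear_combination h0 - (b ^ 2 - a ^ 2) * k ^ 2 * Real.cosh_sq_sub_sinh_sq (k * p₀.1))
    refine .inl ⟨σ, k, d, hσ, hk, fun p hp => ?_⟩
    rw [hab p hp, Real.sinh_add]; ring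

theorem hasProfile_cosh (hm : m ≠ 0) (hΩ : IsOpen Ω) (hc : IsConnected Ω)
    (hP : ∀ p ∈ Ω, HasPD P (Q p) 0 p) (hQ : ∀ p ∈ Ω, HasPD Q (C * P p) 0 p)
    (h : ∀ p ∈ Ω, Q p ^ 2 = -m ^ 2 + C * P p ^ 2) : HasProfile P m Real.cosh Ω := by
  have hm' : 0 < |m| := abs_pos.2 hm
  obtain ⟨p₀, hp₀⟩ := hc.nonempty
  -- Otherwise `Q² = -m² + C P²` would be negative.
  have hC : 0 < C := by
    by_contra hC
    nlinarith [h p₀ hp₀, sq_nonneg (Q p₀), sq_nonneg (P p₀), pow_pos hm' 2, sq_abs m]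
  obtain ⟨k, hk, rfl⟩ : ∃ k : ℝ, 0 < k ∧ C = k ^ 2 :=
    ⟨√C, Real.sqrt_pos.2 hC, by rw [Real.sq_sqrt hC.le]⟩
  obtain ⟨a, b, hab, hab'⟩ := solution_hyperbolic hk.ne' hΩ hc hP hQ
  obtain ⟨σ, d, hσ, rfl, rfl⟩ := exists_hyperbolic_angle (a := b) (b := a) (r := |m| / k)
    (by positivity) (by
      have h0 := h p₀ hp₀
      rw [hab p₀ hp₀, hab' p₀ hp₀] at h0
      rw [div_pow, sq_abs]
      field_simp
      linear_combination -h0 - (a ^ 2 - b ^ 2) * k ^ 2 * Real.cosh_sq_sub_sinh_sq (k * p₀.1))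
  refine ⟨σ, k, d, hσ, hk, fun p hp => ?_⟩
  rw [hab p hp, Real.cosh_add]; ring

end ConformalFactor

/-! ### Structure equations and the equations of Gauss and Codazzi. -/

section StructureEquations

variable {Ω : Set (ℝ × ℝ)}

theorem contDiffOn_lip {x y : ℝ × ℝ → E} (hx : ContDiffOn ℝ ∞ x Ω) (hy : ContDiffOn ℝ ∞ y Ω) :
    ContDiffOn ℝ ∞ (fun p => lip (x p) (y p)) Ω := by
  rw [contDiffOn_pi] at hx hy
  exact (((hx 0).mul (hy 0)).add ((hx 1).mul (hy 1))).sub ((hx 2).mul (hy 2))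

theorem contDiffOn_cross {x y : ℝ × ℝ → E} (hx : ContDiffOn ℝ ∞ x Ω)
    (hy : ContDiffOn ℝ ∞ y Ω) : ContDiffOn ℝ ∞ (fun p => cross (x p) (y p)) Ω := by
  rw [contDiffOn_pi] at hx hy
  refine contDiffOn_pi.2 fun i => ?_
  fin_cases i
  · exact ((hx 1).mul (hy 2)).sub ((hx 2).mul (hy 1))
  · exact ((hx 2).mul (hy 0)).sub ((hx 0).mul (hy 2))
  · exact (((hx 0).mul (hy 1)).sub ((hx 1).mul (hy 0))).neg

/-- The equations of Gauss and Codazzi. -/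
theorem gauss_codazzi {η δ : ℝ} (hη : η = 1 ∨ η = -1) (hδ : δ = 1 ∨ δ = -1) (hΩ : IsOpen Ω)
    {P Q Q₁ e e₁ f f₁ : ℝ × ℝ → ℝ} {U V n : ℝ × ℝ → E}
    (hP0 : ∀ p ∈ Ω, P p ≠ 0)
    (hUU : ∀ p ∈ Ω, lip (U p) (U p) = δ * P p ^ 2)
    (hVV : ∀ p ∈ Ω, lip (V p) (V p) = -(η * δ) * P p ^ 2)
    (hnn : ∀ p ∈ Ω, lip (n p) (n p) = η * P p ^ 2)
    (hUV : ∀ p ∈ Ω, lip (U p) (V p) = 0)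
    (hUn : ∀ p ∈ Ω, lip (U p) (n p) = 0)
    (hVn : ∀ p ∈ Ω, lip (V p) (n p) = 0)
    (hP : ∀ p ∈ Ω, HasPD P (Q p) 0 p) (hQ : ∀ p ∈ Ω, HasPD Q (Q₁ p) 0 p)
    (he : ∀ p ∈ Ω, HasPD e (e₁ p) 0 p) (hf : ∀ p ∈ Ω, HasPD f (f₁ p) 0 p)
    (hU : ∀ p ∈ Ω, HasPD U ((P p)⁻¹ • (Q p • U p + (η * e p) • n p))
      ((P p)⁻¹ • (Q p • V p + (η * f p) • n p)) p)
    (hV : ∀ p ∈ Ω, HasPD V ((P p)⁻¹ • (Q p • V p + (η * f p) • n p))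
      ((P p)⁻¹ • ((η * Q p) • U p + e p • n p)) p)
    (hn : ∀ p ∈ Ω, HasPD n ((P p)⁻¹ • (Q p • n p - δ • (e p • U p - (η * f p) • V p)))
      ((P p)⁻¹ • (-(δ • (f p • U p - e p • V p)))) p) {p : ℝ × ℝ} (hp : p ∈ Ω) :
    e₁ p = 0 ∧ f₁ p = 0 ∧ Q₁ p * P p - Q p ^ 2 = η * δ * (e p ^ 2 - η * f p ^ 2) := by
  have hi := (hP p hp).inv (hP0 p hp)
  have hA := hi.smul (((hQ p hp).smul (hU p hp)).add (((he p hp).const_smul η).smul (hn p hp)))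
  have hB := hi.smul (((hQ p hp).smul (hV p hp)).add (((hf p hp).const_smul η).smul (hn p hp)))
  have hD := hi.smul ((((hQ p hp).const_smul η).smul (hU p hp)).add ((he p hp).smul (hn p hp)))
  -- The normal part of `U_uv = U_vu` gives `f₁ = 0` and its `V` part is the Gauss equation; the
  -- normal part of `V_uv = V_vu` gives `e₁ = 0`.
  have h1 := mixed_partials hΩ hp hU hA hB
  have h2 := mixed_partials hΩ hp hV hB hD
  have h0 := hP0 p hp
  have hnV : lip (n p) (V p) = 0 := by rw [lip_comm, hVn p hp]
  have h1n := congrArg (lip · (n p)) h1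
  have h1V := congrArg (lip · (V p)) h1
  have h2n := congrArg (lip · (n p)) h2
  simp only [lip_add_left, lip_sub_left, lip_neg_left, lip_smul_left, smul_eq_mul,
    hVV p hp, hnn p hp, hUV p hp, hUn p hp, hVn p hp, hnV] at h1n h1V h2n
  field_simp at h1n h1V h2n
  rcases hη with rfl | rfl <;> rcases hδ with rfl | rfl <;>
  refine ⟨mul_left_cancel₀ (pow_ne_zero 3 h0) ?_, mul_left_cancel₀ (pow_ne_zero 3 h0) ?_,
    mul_left_cancel₀ (pow_ne_zero 2 h0) ?_⟩ <;>
  first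
  | linear_combination -h2n
  | linear_combination h2n
  | linear_combination -h1n
  | linear_combination h1V
  | linear_combination -h1V

/-- A zero mean curvature surface with conformal parameters, whose fundamental forms depend on
the first parameter only, satisfies the structure equations with constant second
fundamental form. -/
theorem exists_frame {X : ℝ × ℝ → E} {η δ : ℝ} (hη : η = 1 ∨ η = -1) (hδ : δ = 1 ∨ δ = -1)
    (hΩ : IsOpen Ω) (hc : IsConnected Ω) (hX : ContDiffOn ℝ ∞ X Ω) {ρ φ ψ : ℝ → ℝ}
    (hρ : ∀ p ∈ Ω, 0 < ρ p.1)
    (hI : ∀ p ∈ Ω, firstForm X p = ρ p.1 ^ 2 • !![δ, 0; 0, -(η * δ)])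
    (hII : ∀ p ∈ Ω, secondForm X p = !![φ p.1, ψ p.1; ψ p.1, η * φ p.1]) :
    ∃ (e f : ℝ) (Q Q₁ : ℝ × ℝ → ℝ) (U V n : ℝ × ℝ → E),
      IsFrame η δ e f (fun p => ρ p.1) Q U V n Ω ∧ (∀ p ∈ Ω, HasPD X (U p) (V p) p) ∧
      (∀ p ∈ Ω, φ p.1 = e ∧ ψ p.1 = f) ∧ (∀ p ∈ Ω, HasPD Q (Q₁ p) 0 p) ∧
      ∀ p ∈ Ω, Q₁ p * ρ p.1 - Q p ^ 2 = η * δ * (e ^ 2 - η * f ^ 2) := by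
  have hη2 : η * η = 1 := by rcases hη with rfl | rfl <;> norm_num
  have hδ2 : δ * δ = 1 := by rcases hδ with rfl | rfl <;> norm_num
  set P : ℝ × ℝ → ℝ := fun p => ρ p.1
  have hP0 : ∀ p ∈ Ω, P p ≠ 0 := fun p hp => (hρ p hp).ne'
  have hUs : ContDiffOn ℝ ∞ (du X) Ω := contDiffOn_fderiv_apply hX hΩ _
  have hVs : ContDiffOn ℝ ∞ (dv X) Ω := contDiffOn_fderiv_apply hX hΩ _
  have hXd : ∀ p ∈ Ω, HasPD X (du X p) (dv X p) p := fun p hp => hasPD_of_contDiffOn hX hΩ hp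
  have hUd : ∀ p ∈ Ω, HasPD (du X) (du (du X) p) (dv (du X) p) p :=
    fun p hp => hasPD_of_contDiffOn hUs hΩ hp
  have hVd : ∀ p ∈ Ω, HasPD (dv X) (du (dv X) p) (dv (dv X) p) p :=
    fun p hp => hasPD_of_contDiffOn hVs hΩ hp
  have hmix : ∀ p ∈ Ω, dv (du X) p = du (dv X) p := fun p hp =>
    mixed_partials hΩ hp hXd (hUd p hp) (hVd p hp)
  generalize hUe : du X = U at *
  generalize hVe : dv X = V at *
  have hUU : ∀ p ∈ Ω, lip (U p) (U p) = δ * P p ^ 2 := fun p hp => by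
    simpa [firstForm, mul_comm, hUe, hVe] using congrFun₂ (hI p hp) 0 0
  have hUV : ∀ p ∈ Ω, lip (U p) (V p) = 0 := fun p hp => by
    simpa [firstForm, hUe, hVe] using congrFun₂ (hI p hp) 0 1
  have hVV : ∀ p ∈ Ω, lip (V p) (V p) = -(η * δ) * P p ^ 2 := fun p hp => by
    simpa [firstForm, mul_comm, hUe, hVe] using congrFun₂ (hI p hp) 1 1
  -- Smoothness of `ρ` is not assumed; it is inherited from `X` through `P = √(δ ⟨U, U⟩)`.
  have hPs : ContDiffOn ℝ ∞ P Ω := by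
    have h1 : ContDiffOn ℝ ∞ (fun p => √(δ * lip (U p) (U p))) Ω := by
      refine (contDiffOn_const.mul (contDiffOn_lip hUs hUs)).sqrt fun p hp => ?_
      rw [hUU p hp, ← mul_assoc, hδ2, one_mul]
      exact pow_ne_zero 2 (hP0 p hp)
    refine h1.congr fun p hp => ?_
    rw [hUU p hp, ← mul_assoc, hδ2, one_mul, Real.sqrt_sq (hρ p hp).le]
  obtain ⟨Q, Q', hQs, -, hPd'⟩ := exists_partials hPs hΩ
  have hPd : ∀ p ∈ Ω, HasPD P (Q p) 0 p := fun p hp =>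
    (hPd' p hp).congr_values rfl ((hPd' p hp).right_eq_zero hΩ hp (φ := ρ) fun _ _ => rfl)
  obtain ⟨Q₁, Q₁', -, -, hQd'⟩ := exists_partials hQs hΩ
  have hQd : ∀ p ∈ Ω, HasPD Q (Q₁ p) 0 p := fun p hp => by
    refine (hQd' p hp).congr_values rfl ?_
    exact mixed_partials hΩ hp hPd (hQd' p hp) (HasPD.const (0 : ℝ) p)
  -- This is `P` times the unit normal. All three frame fields then have length of order `P`, and
  -- every structure equation has the single denominator `P`.
  set n : ℝ × ℝ → E := fun p => (P p)⁻¹ • cross (U p) (V p) with hn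
  have hns : ContDiffOn ℝ ∞ n Ω := (hPs.inv hP0).smul (contDiffOn_cross hUs hVs)
  obtain ⟨nu, nv, -, -, hnd⟩ := exists_partials hns hΩ
  have hcc : ∀ p ∈ Ω, lip (cross (U p) (V p)) (cross (U p) (V p)) = η * P p ^ 4 := fun p hp => by
    rw [lip_cross_cross, hUU p hp, hVV p hp, hUV p hp]
    linear_combination η * P p ^ 4 * hδ2
  have hnn : ∀ p ∈ Ω, lip (n p) (n p) = η * P p ^ 2 := fun p hp => by
    have := hP0 p hp
    simp only [hn, lip_smul_left, lip_smul_right, hcc p hp]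
    field_simp
  have hUn : ∀ p ∈ Ω, lip (U p) (n p) = 0 := fun p hp => by
    rw [lip_comm]; simp only [hn, lip_smul_left, lip_cross_self_left, mul_zero]
  have hVn : ∀ p ∈ Ω, lip (V p) (n p) = 0 := fun p hp => by
    rw [lip_comm]; simp only [hn, lip_smul_left, lip_cross_self_right, mul_zero]
  have hN : ∀ p ∈ Ω, unitNormal X p = (P p)⁻¹ • n p := fun p hp => by
    have h2 : |η * P p ^ 4| = (P p ^ 2) ^ 2 := by
      rw [abs_mul, show |η| = 1 by rcases hη with rfl | rfl <;> norm_num,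
        abs_of_nonneg (by positivity)]; ring
    rw [unitNormal, hUe, hVe, hcc p hp, h2, Real.sqrt_sq (by positivity), hn, smul_smul]
    congr 1
    rw [← mul_inv, sq]
  have hsec : ∀ p ∈ Ω, lip (du U p) (n p) = P p * φ p.1 ∧ lip (dv U p) (n p) = P p * ψ p.1 ∧
      lip (dv V p) (n p) = P p * (η * φ p.1) := fun p hp => by
    have h := hII p hp
    have h0 := hP0 p hp
    have e00 := congrFun₂ h 0 0
    have e01 := congrFun₂ h 0 1
    have e11 := congrFun₂ h 1 1
    simp [secondForm, hN p hp, lip_smul_right, hUe, hVe] at e00 e01 e11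
    rw [← e00, ← e01]
    refine ⟨?_, ?_, ?_⟩
    · field_simp
    · field_simp
    · rw [e00, ← e11]; field_simp
  have hexp : ∀ p ∈ Ω, ∀ x, x = ((P p)⁻¹) ^ 2 • ((δ * lip x (U p)) • U p +
      (-(η * δ) * lip x (V p)) • V p + (η * lip x (n p)) • n p) := fun p hp x =>
    orthogonal_expansion hδ2 (by linear_combination δ * δ * hη2 + hδ2) hη2 (hP0 p hp) (hUU p hp)
      (hVV p hp) (hnn p hp) (hUV p hp) (hUn p hp) (hVn p hp) x
  have dP2 : ∀ (s : ℝ), ∀ p ∈ Ω, HasPD (fun p => s * P p ^ 2) (s * (2 * P p * Q p)) 0 p := by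
    intro s p hp
    refine ((((hPd p hp).mul (hPd p hp)).const_smul s).congr_on hΩ hp
      fun q _ => ?_).congr_values ?_ ?_ <;> simp only [smul_eq_mul] <;> ring
  -- Differentiating the Gram relations of the frame, together with `U_v = V_u`, determines all
  -- components of the derivatives not already given by the second fundamental form.
  have gram : ∀ {x y : ℝ × ℝ → E} {a b c d : E} {s : ℝ} {p : ℝ × ℝ}, p ∈ Ω → HasPD x a b p →
      HasPD y c d p → (∀ q ∈ Ω, lip (x q) (y q) = s * P q ^ 2) →
      lip (x p) c + lip a (y p) = s * (2 * P p * Q p) ∧ lip (x p) d + lip b (y p) = 0 :=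
    fun {x y a b c d s p} hp hx hy h =>
      ((hx.lip hy).congr_on hΩ hp fun q hq => (h q hq).symm).unique (dP2 s p hp)
  have gram0 : ∀ {x y : ℝ × ℝ → E} {a b c d : E} {p : ℝ × ℝ}, p ∈ Ω → HasPD x a b p →
      HasPD y c d p → (∀ q ∈ Ω, lip (x q) (y q) = 0) →
      lip (x p) c + lip a (y p) = 0 ∧ lip (x p) d + lip b (y p) = 0 :=
    fun {x y a b c d p} hp hx hy h => by
      have := gram (s := 0) hp hx hy (fun q hq => by rw [h q hq, zero_mul])
      simpa using this
  have key : ∀ p ∈ Ω, du U p = (P p)⁻¹ • (Q p • U p + (η * φ p.1) • n p) ∧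
      dv U p = (P p)⁻¹ • (Q p • V p + (η * ψ p.1) • n p) ∧
      dv V p = (P p)⁻¹ • ((η * Q p) • U p + φ p.1 • n p) ∧
      nu p = (P p)⁻¹ • (Q p • n p - δ • (φ p.1 • U p - (η * ψ p.1) • V p)) ∧
      nv p = (P p)⁻¹ • (-(δ • (ψ p.1 • U p - φ p.1 • V p))) := by
    intro p hp
    obtain ⟨s1, s2, s3⟩ := hsec p hp
    obtain ⟨a1, a2⟩ := gram hp (hUd p hp) (hUd p hp) hUU
    obtain ⟨b1, b2⟩ := gram0 hp (hUd p hp) (hVd p hp) hUV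
    obtain ⟨c1, c2⟩ := gram hp (hVd p hp) (hVd p hp) hVV
    obtain ⟨d1, d2⟩ := gram hp (hnd p hp) (hnd p hp) hnn
    obtain ⟨f1, f2⟩ := gram0 hp (hUd p hp) (hnd p hp) hUn
    obtain ⟨g1, g2⟩ := gram0 hp (hVd p hp) (hnd p hp) hVn
    rw [← hmix p hp] at b1 c1 g1
    rw [lip_comm (U p)] at a1 a2 b1 b2 f1 f2
    rw [lip_comm (V p)] at c1 c2 g1 g2
    rw [lip_comm (n p)] at d1 d2
    have h0 := hP0 p hp
    have hi : (P p)⁻¹ * P p = 1 := inv_mul_cancel₀ h0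
    have u1 : lip (du U p) (U p) = δ * (P p * Q p) := by linear_combination a1 / 2
    have u2 : lip (dv U p) (U p) = 0 := by linear_combination a2 / 2
    have u3 : lip (dv U p) (V p) = -(η * δ) * (P p * Q p) := by linear_combination c1 / 2
    have u4 : lip (dv V p) (V p) = 0 := by linear_combination c2 / 2
    have u5 : lip (du U p) (V p) = 0 := by linear_combination b1 - u2
    have u6 : lip (dv V p) (U p) = η * δ * (P p * Q p) := by linear_combination b2 - u3
    have u7 : lip (nu p) (n p) = η * (P p * Q p) := by linear_combination d1 / 2
    have u8 : lip (nv p) (n p) = 0 := by linear_combination d2 / 2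
    have u9 : lip (nu p) (U p) = -(P p * φ p.1) := by linear_combination f1 - s1
    have v1 : lip (nv p) (U p) = -(P p * ψ p.1) := by linear_combination f2 - s2
    have v2 : lip (nu p) (V p) = -(P p * ψ p.1) := by linear_combination g1 - s2
    have v3 : lip (nv p) (V p) = -(P p * (η * φ p.1)) := by linear_combination g2 - s3
    have red : ∀ {x w : E}, x = ((P p)⁻¹) ^ 2 • w → ∀ {z : E}, w = P p • z → x = (P p)⁻¹ • z := by
      intro x w h z hz
      rw [h, hz, smul_smul, sq, mul_assoc, hi, mul_one]
    refine ⟨red (hexp p hp _) ?_, red (hexp p hp _) ?_, red (hexp p hp _) ?_, red (hexp p hp _) ?_,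
      red (hexp p hp _) ?_⟩
    · rw [u1, u5, s1]
      rcases hη with rfl | rfl <;> rcases hδ with rfl | rfl <;> module
    · rw [u2, u3, s2]
      rcases hη with rfl | rfl <;> rcases hδ with rfl | rfl <;> module
    · rw [u6, u4, s3]
      rcases hη with rfl | rfl <;> rcases hδ with rfl | rfl <;> module
    · rw [u9, v2, u7]
      rcases hη with rfl | rfl <;> rcases hδ with rfl | rfl <;> module
    · rw [v1, v3, u8]
      rcases hη with rfl | rfl <;> rcases hδ with rfl | rfl <;> module
  -- `φ` and `ψ` are arbitrary functions of `u`; their smoothness on `Ω` comes from writing them as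
  -- `P⁻¹ ⟨w, n⟩`.
  have hsm : ∀ (χ : ℝ → ℝ) (w : ℝ × ℝ → E), ContDiffOn ℝ ∞ w Ω →
      (∀ p ∈ Ω, lip (w p) (n p) = P p * χ p.1) →
      ∃ χ₁ : ℝ × ℝ → ℝ, ∀ p ∈ Ω, HasPD (fun p => χ p.1) (χ₁ p) 0 p := by
    intro χ w hw h
    have h1 : ContDiffOn ℝ ∞ (fun p : ℝ × ℝ => χ p.1) Ω := by
      refine ((hPs.inv hP0).mul (contDiffOn_lip hw hns)).congr fun p hp => ?_
      have h0 := hP0 p hp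
      simp only [h p hp, Pi.inv_apply]
      field_simp
    obtain ⟨χ₁, χ₂, -, -, h2⟩ := exists_partials h1 hΩ
    exact ⟨χ₁, fun p hp => (h2 p hp).congr_values rfl
      ((h2 p hp).right_eq_zero hΩ hp (φ := χ) fun _ _ => rfl)⟩
  obtain ⟨φ₁, hφ⟩ := hsm φ (du U) (contDiffOn_fderiv_apply hUs hΩ _) fun p hp => (hsec p hp).1
  obtain ⟨ψ₁, hψ⟩ := hsm ψ (dv U) (contDiffOn_fderiv_apply hUs hΩ _) fun p hp => (hsec p hp).2.1
  have fU : ∀ p ∈ Ω, HasPD U ((P p)⁻¹ • (Q p • U p + (η * φ p.1) • n p))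
      ((P p)⁻¹ • (Q p • V p + (η * ψ p.1) • n p)) p := fun p hp =>
    (hUd p hp).congr_values (key p hp).1 (key p hp).2.1
  have fV : ∀ p ∈ Ω, HasPD V ((P p)⁻¹ • (Q p • V p + (η * ψ p.1) • n p))
      ((P p)⁻¹ • ((η * Q p) • U p + φ p.1 • n p)) p := fun p hp =>
    (hVd p hp).congr_values ((hmix p hp).symm.trans (key p hp).2.1) (key p hp).2.2.1
  have fn : ∀ p ∈ Ω, HasPD n
      ((P p)⁻¹ • (Q p • n p - δ • (φ p.1 • U p - (η * ψ p.1) • V p)))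
      ((P p)⁻¹ • (-(δ • (ψ p.1 • U p - φ p.1 • V p)))) p := fun p hp =>
    (hnd p hp).congr_values (key p hp).2.2.2.1 (key p hp).2.2.2.2
  have gc := fun (p : ℝ × ℝ) (hp : p ∈ Ω) => gauss_codazzi hη hδ hΩ hP0 hUU hVV hnn hUV hUn hVn
    hPd hQd hφ hψ fU fV fn hp
  obtain ⟨e, he⟩ := HasPD.exists_const hΩ hc fun p hp =>
    (hφ p hp).congr_values (gc p hp).1 rfl
  obtain ⟨f, hf⟩ := HasPD.exists_const hΩ hc fun p hp =>
    (hψ p hp).congr_values (gc p hp).2.1 rfl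
  refine ⟨e, f, Q, Q₁, U, V, n, ⟨hP0, hUU, hVV, hnn, hUV, hUn, hVn, hPd, fun p hp => ?_,
    fun p hp => ?_, fun p hp => ?_⟩, hXd, fun p hp => ⟨he p hp, hf p hp⟩, hQd, fun p hp => ?_⟩
  · rw [← he p hp, ← hf p hp]; exact fU p hp
  · rw [← he p hp, ← hf p hp]; exact fV p hp
  · rw [← he p hp, ← hf p hp]; exact fn p hp
  · rw [← he p hp, ← hf p hp]; exact (gc p hp).2.2

end StructureEquations

/-! ### The seven catenoids and their conjugate surfaces. -/

section Catenoids

theorem HasPD.of_deriv {f : ℝ × ℝ → ℝ} {a b : ℝ} {p : ℝ × ℝ} (hd : DifferentiableAt ℝ f p)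
    (h₁ : deriv (fun x => f (x, p.2)) p.1 = a) (h₂ : deriv (fun y => f (p.1, y)) p.2 = b) :
    HasPD f a b p := by
  have h1 : HasDerivAt (fun x : ℝ => (x, p.2)) ((1 : ℝ), (0 : ℝ)) p.1 :=
    (hasDerivAt_id _).prodMk (hasDerivAt_const _ _)
  have h2 : HasDerivAt (fun y : ℝ => (p.1, y)) ((0 : ℝ), (1 : ℝ)) p.2 :=
    (hasDerivAt_const _ _).prodMk (hasDerivAt_id _)
  refine (HasPD.of_hasFDerivAt hd.hasFDerivAt).congr_values ?_ ?_
  · exact (HasFDerivAt.comp_hasDerivAt (l := f) (f := fun x : ℝ => (x, p.2)) p.1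
      hd.hasFDerivAt h1).deriv.symm.trans h₁
  · exact (HasFDerivAt.comp_hasDerivAt (l := f) (f := fun y : ℝ => (p.1, y)) p.2
      hd.hasFDerivAt h2).deriv.symm.trans h₂

/-- The surface of revolution `C` with conjugate surface, coordinate fields `W` and `T` and
conformal factor `h`, normalized so that the second fundamental form is `du² + η dv²`. -/
structure IsCatenoid (η δ : ℝ) (h h' : ℝ → ℝ) (C Cs W T n : ℝ × ℝ → E) : Prop where
  contDiff : ContDiff ℝ ∞ C
  contDiff_conj : ContDiff ℝ ∞ Cs
  hasPD : ∀ p, HasPD C (W p) (T p) p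
  hasPD_conj : ∀ p, HasPD Cs (η • T p) (W p) p
  isFrame : IsFrame η δ 1 0 (fun p => h p.1) (fun p => h' p.1) W T n {p | h p.1 ≠ 0}
  revolution : ∃ rot : ℝ → Matrix (Fin 3) (Fin 3) ℝ,
    (rot = rotTimelike ∨ rot = rotSpacelike ∨ rot = rotLightlike) ∧
    ∃ γ : ℝ → E, ContDiff ℝ ∞ γ ∧ ∀ p, C p = rot p.2 *ᵥ γ p.1

/-- With the denominator `h` cleared, the structure equations are identities valid at every point,
including the singular points where `h` vanishes; division happens only off that set. -/
theorem isFrame_of_mul {η δ : ℝ} {h h' : ℝ → ℝ} {W T n : ℝ × ℝ → E}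
    (hd : ∀ w, HasDerivAt h (h' w) w)
    {Wu Wt Tt nu nt : ℝ × ℝ → E}
    (hW : ∀ p, HasPD W (Wu p) (Wt p) p) (hT : ∀ p, HasPD T (Wt p) (Tt p) p)
    (hn : ∀ p, HasPD n (nu p) (nt p) p)
    (hWW : ∀ p, lip (W p) (W p) = δ * h p.1 ^ 2)
    (hTT : ∀ p, lip (T p) (T p) = -(η * δ) * h p.1 ^ 2)
    (hnn : ∀ p, lip (n p) (n p) = η * h p.1 ^ 2) (hWT : ∀ p, lip (W p) (T p) = 0)
    (hWn : ∀ p, lip (W p) (n p) = 0) (hTn : ∀ p, lip (T p) (n p) = 0)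
    (eWu : ∀ p, h p.1 • Wu p = h' p.1 • W p + η • n p)
    (eWt : ∀ p, h p.1 • Wt p = h' p.1 • T p)
    (eTt : ∀ p, h p.1 • Tt p = (η * h' p.1) • W p + n p)
    (enu : ∀ p, h p.1 • nu p = h' p.1 • n p - δ • W p)
    (ent : ∀ p, h p.1 • nt p = δ • T p) :
    IsFrame η δ 1 0 (fun p => h p.1) (fun p => h' p.1) W T n {p | h p.1 ≠ 0} := by
  have key : ∀ {r : ℝ} {x y : E}, r ≠ 0 → r • x = y → x = r⁻¹ • y := fun hr hxy => by
    rw [← hxy, inv_smul_smul₀ hr]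
  refine ⟨fun p hp => hp, fun p _ => hWW p, fun p _ => hTT p, fun p _ => hnn p, fun p _ => hWT p,
    fun p _ => hWn p, fun p _ => hTn p, fun p _ => HasPD.comp_fst (hd p.1),
    fun p hp => (hW p).congr_values (key hp ?_) (key hp ?_),
    fun p hp => (hT p).congr_values (key hp ?_) (key hp ?_),
    fun p hp => (hn p).congr_values (key hp ?_) (key hp ?_)⟩
  · rw [eWu]; module
  · rw [eWt]; module
  · rw [eWt]; module
  · rw [eTt]; module
  · rw [enu]; module
  · rw [ent]; module

open Real in
-- The conjugate surface is a helicoid about the same axis. The field `n` is `-h⁻¹` times the cross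
-- product of `W` and `T`: its sign is chosen to make the second fundamental form `dw² - dt²`, and a
-- frame may have either orientation.
theorem isCatenoid_elliptic : IsCatenoid (-1) 1 sinh cosh ellipticCatenoid
    (fun p => ![cosh p.1 * sin p.2, -(cosh p.1 * cos p.2), p.2])
    (fun p => ![cosh p.1 * cos p.2, cosh p.1 * sin p.2, 1])
    (fun p => ![-(sinh p.1 * sin p.2), sinh p.1 * cos p.2, 0])
    (fun p => ![cos p.2, sin p.2, cosh p.1]) where
  contDiff := contDiff_pi.2 fun i => by
    fin_cases i <;> simp [ellipticCatenoid] <;> fun_prop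
  contDiff_conj := contDiff_pi.2 fun i => by fin_cases i <;> simp <;> fun_prop
  hasPD p := by
    refine HasPD.vec (.of_deriv ?_ ?_ ?_) (.of_deriv ?_ ?_ ?_) (.of_deriv ?_ ?_ ?_) <;>
      first | fun_prop | simp
  hasPD_conj p := by
    refine (HasPD.vec (.of_deriv ?_ rfl rfl) (.of_deriv ?_ rfl rfl)
      (.of_deriv ?_ rfl rfl)).congr_values ?_ ?_ <;>
      first | fun_prop | (ext i; fin_cases i <;> simp)
  isFrame := by
    refine isFrame_of_mul hasDerivAt_sinh
      (Wu := fun p => ![sinh p.1 * cos p.2, sinh p.1 * sin p.2, 0])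
      (Wt := fun p => ![-(cosh p.1 * sin p.2), cosh p.1 * cos p.2, 0])
      (Tt := fun p => ![-(sinh p.1 * cos p.2), -(sinh p.1 * sin p.2), 0])
      (nu := fun p => ![0, 0, sinh p.1]) (nt := fun p => ![-sin p.2, cos p.2, 0])
      ?_ ?_ ?_ ?_ ?_ ?_ ?_ ?_ ?_ ?_ ?_ ?_ ?_ ?_ <;> intro p
    iterate 3
      refine HasPD.vec (.of_deriv ?_ ?_ ?_) (.of_deriv ?_ ?_ ?_) (.of_deriv ?_ ?_ ?_) <;>
      first | fun_prop | simp
    all_goals have h1 := cosh_sq_sub_sinh_sq p.1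
    all_goals have h2 := sin_sq_add_cos_sq p.2
    iterate 6 simp only [lip, Matrix.cons_val]; grind
    all_goals ext i; fin_cases i <;> simp <;> grind
  revolution := ⟨rotTimelike, .inl rfl, fun w => ![sinh w, 0, w],
    contDiff_pi.2 fun i => by fin_cases i <;> simp <;> fun_prop, fun p => by
      ext i
      fin_cases i <;> simp [ellipticCatenoid, rotTimelike, Matrix.mulVec, dotProduct,
        Fin.sum_univ_three] <;> ring⟩

open Real in
-- The parabolic catenoid has conformal factor `2w`; halving it yields the profile `w` and the
-- normalized second fundamental form.
theorem isCatenoid_parabolic : IsCatenoid (-1) (1) id (fun _ => 1)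
    (fun p => (1 / 2 : ℝ) • parabolicCatenoid p)
    (fun p => ![p.1 ^ 2 * p.2 / 2 + p.2 / 2 - p.2 ^ 3 / 6, p.1 ^ 2 / 2 - p.2 ^ 2 / 2, p.1 ^ 2 * p.2 / 2 - p.2 / 2 - p.2 ^ 3 / 6])
    (fun p => ![(p.1 ^ 2 + 1 - p.2 ^ 2) / 2, -p.2, (p.1 ^ 2 - 1 - p.2 ^ 2) / 2])
    (fun p => ![-(p.1 * p.2), -p.1, -(p.1 * p.2)])
    (fun p => ![-((p.1 ^ 2 - 1 + p.2 ^ 2) / 2), -p.2, -((p.1 ^ 2 + 1 + p.2 ^ 2) / 2)]) where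
  contDiff := contDiff_pi.2 fun i => by
    fin_cases i <;> simp [parabolicCatenoid] <;> fun_prop
  contDiff_conj := contDiff_pi.2 fun i => by fin_cases i <;> simp <;> fun_prop
  hasPD p := by
    refine (HasPD.const_smul (1 / 2) (HasPD.vec (.of_deriv ?_ rfl rfl) (.of_deriv ?_ rfl rfl)
      (.of_deriv ?_ rfl rfl))).congr_values ?_ ?_ <;>
      first | fun_prop | (ext i; fin_cases i <;> simp (disch := fun_prop) <;> ring)
  hasPD_conj p := by
    refine (HasPD.vec (.of_deriv ?_ rfl rfl) (.of_deriv ?_ rfl rfl)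
      (.of_deriv ?_ rfl rfl)).congr_values ?_ ?_ <;>
      first | fun_prop | (ext i; fin_cases i <;> simp (disch := fun_prop) <;> ring)
  isFrame := by
    refine isFrame_of_mul hasDerivAt_id
      (Wu := fun p => ![p.1, 0, p.1])
      (Wt := fun p => ![-p.2, -1, -p.2])
      (Tt := fun p => ![-p.1, 0, -p.1])
      (nu := fun p => ![-p.1, 0, -p.1])
      (nt := fun p => ![-p.2, -1, -p.2])
      ?_ ?_ ?_ ?_ ?_ ?_ ?_ ?_ ?_ ?_ ?_ ?_ ?_ ?_ <;> intro p
    iterate 3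
      refine (HasPD.vec (.of_deriv ?_ rfl rfl) (.of_deriv ?_ rfl rfl)
        (.of_deriv ?_ rfl rfl)).congr_values ?_ ?_ <;>
      first | fun_prop | (ext i; fin_cases i <;> simp (disch := fun_prop) <;> ring)
    iterate 6 simp only [lip, Matrix.cons_val]; grind
    all_goals ext i; fin_cases i <;> simp <;> grind
  revolution := ⟨rotLightlike, .inr (.inr rfl), fun w => ![(w ^ 3 / 3 + w) / 2, 0, (w ^ 3 / 3 - w) / 2],
    contDiff_pi.2 fun i => by fin_cases i <;> simp <;> fun_prop, fun p => by
      ext i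
      fin_cases i <;> simp [parabolicCatenoid, rotLightlike, Matrix.mulVec, dotProduct,
        Fin.sum_univ_three] <;> ring⟩

open Real in
theorem isCatenoid_hyperbolic : IsCatenoid (-1) (1) sin cos
    hyperbolicCatenoid
    (fun p => ![p.2, cos p.1 * cosh p.2, cos p.1 * sinh p.2])
    (fun p => ![1, cos p.1 * sinh p.2, cos p.1 * cosh p.2])
    (fun p => ![0, sin p.1 * cosh p.2, sin p.1 * sinh p.2])
    (fun p => ![cos p.1, sinh p.2, cosh p.2]) where
  contDiff := contDiff_pi.2 fun i => by
    fin_cases i <;> simp [hyperbolicCatenoid] <;> fun_prop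
  contDiff_conj := contDiff_pi.2 fun i => by fin_cases i <;> simp <;> fun_prop
  hasPD p := by
    refine (HasPD.vec (.of_deriv ?_ rfl rfl) (.of_deriv ?_ rfl rfl)
      (.of_deriv ?_ rfl rfl)).congr_values ?_ ?_ <;>
      first | fun_prop | (ext i; fin_cases i <;> simp)
  hasPD_conj p := by
    refine (HasPD.vec (.of_deriv ?_ rfl rfl) (.of_deriv ?_ rfl rfl)
      (.of_deriv ?_ rfl rfl)).congr_values ?_ ?_ <;>
      first | fun_prop | (ext i; fin_cases i <;> simp)
  isFrame := by
    refine isFrame_of_mul hasDerivAt_sin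
      (Wu := fun p => ![0, -(sin p.1 * sinh p.2), -(sin p.1 * cosh p.2)])
      (Wt := fun p => ![0, cos p.1 * cosh p.2, cos p.1 * sinh p.2])
      (Tt := fun p => ![0, sin p.1 * sinh p.2, sin p.1 * cosh p.2])
      (nu := fun p => ![-sin p.1, 0, 0])
      (nt := fun p => ![0, cosh p.2, sinh p.2])
      ?_ ?_ ?_ ?_ ?_ ?_ ?_ ?_ ?_ ?_ ?_ ?_ ?_ ?_ <;> intro p
    iterate 3
      refine (HasPD.vec (.of_deriv ?_ rfl rfl) (.of_deriv ?_ rfl rfl)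
        (.of_deriv ?_ rfl rfl)).congr_values ?_ ?_ <;>
      first | fun_prop | (ext i; fin_cases i <;> simp)
    all_goals have h1 := sin_sq_add_cos_sq p.1
    all_goals have h2 := cosh_sq_sub_sinh_sq p.2
    iterate 6 simp only [lip, Matrix.cons_val]; grind
    all_goals ext i; fin_cases i <;> simp <;> grind
  revolution := ⟨rotSpacelike, .inr (.inl rfl), fun w => ![w, 0, sin w],
    contDiff_pi.2 fun i => by fin_cases i <;> simp <;> fun_prop, fun p => by
      ext i
      fin_cases i <;> simp [hyperbolicCatenoid, rotSpacelike, Matrix.mulVec, dotProduct,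
        Fin.sum_univ_three] <;> ring⟩

open Real in
theorem isCatenoid_timelike : IsCatenoid (1) (1) cosh sinh
    timelikeCatenoid
    (fun p => ![p.2, sinh p.1 * sinh p.2, sinh p.1 * cosh p.2])
    (fun p => ![1, sinh p.1 * cosh p.2, sinh p.1 * sinh p.2])
    (fun p => ![0, cosh p.1 * sinh p.2, cosh p.1 * cosh p.2])
    (fun p => ![-sinh p.1, cosh p.2, sinh p.2]) where
  contDiff := contDiff_pi.2 fun i => by
    fin_cases i <;> simp [timelikeCatenoid] <;> fun_prop
  contDiff_conj := contDiff_pi.2 fun i => by fin_cases i <;> simp <;> fun_prop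
  hasPD p := by
    refine (HasPD.vec (.of_deriv ?_ rfl rfl) (.of_deriv ?_ rfl rfl)
      (.of_deriv ?_ rfl rfl)).congr_values ?_ ?_ <;>
      first | fun_prop | (ext i; fin_cases i <;> simp)
  hasPD_conj p := by
    refine (HasPD.vec (.of_deriv ?_ rfl rfl) (.of_deriv ?_ rfl rfl)
      (.of_deriv ?_ rfl rfl)).congr_values ?_ ?_ <;>
      first | fun_prop | (ext i; fin_cases i <;> simp)
  isFrame := by
    refine isFrame_of_mul hasDerivAt_cosh
      (Wu := fun p => ![0, cosh p.1 * cosh p.2, cosh p.1 * sinh p.2])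
      (Wt := fun p => ![0, sinh p.1 * sinh p.2, sinh p.1 * cosh p.2])
      (Tt := fun p => ![0, cosh p.1 * cosh p.2, cosh p.1 * sinh p.2])
      (nu := fun p => ![-cosh p.1, 0, 0])
      (nt := fun p => ![0, sinh p.2, cosh p.2])
      ?_ ?_ ?_ ?_ ?_ ?_ ?_ ?_ ?_ ?_ ?_ ?_ ?_ ?_ <;> intro p
    iterate 3
      refine (HasPD.vec (.of_deriv ?_ rfl rfl) (.of_deriv ?_ rfl rfl)
        (.of_deriv ?_ rfl rfl)).congr_values ?_ ?_ <;>
      first | fun_prop | (ext i; fin_cases i <;> simp)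
    all_goals have h1 := cosh_sq_sub_sinh_sq p.1
    all_goals have h2 := cosh_sq_sub_sinh_sq p.2
    iterate 6 simp only [lip, Matrix.cons_val]; grind
    all_goals ext i; fin_cases i <;> simp <;> grind
  revolution := ⟨rotSpacelike, .inr (.inl rfl), fun w => ![w, cosh w, 0],
    contDiff_pi.2 fun i => by fin_cases i <;> simp <;> fun_prop, fun p => by
      ext i
      fin_cases i <;> simp [timelikeCatenoid, rotSpacelike, Matrix.mulVec, dotProduct,
        Fin.sum_univ_three] <;> ring⟩

open Real in
theorem isCatenoid_timelikeHyperbolic : IsCatenoid (1) (-1) sinh cosh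
    timelikeHyperbolicCatenoid
    (fun p => ![p.2, cosh p.1 * cosh p.2, cosh p.1 * sinh p.2])
    (fun p => ![1, cosh p.1 * sinh p.2, cosh p.1 * cosh p.2])
    (fun p => ![0, sinh p.1 * cosh p.2, sinh p.1 * sinh p.2])
    (fun p => ![-cosh p.1, -sinh p.2, -cosh p.2]) where
  contDiff := contDiff_pi.2 fun i => by
    fin_cases i <;> simp [timelikeHyperbolicCatenoid] <;> fun_prop
  contDiff_conj := contDiff_pi.2 fun i => by fin_cases i <;> simp <;> fun_prop
  hasPD p := by
    refine (HasPD.vec (.of_deriv ?_ rfl rfl) (.of_deriv ?_ rfl rfl)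
      (.of_deriv ?_ rfl rfl)).congr_values ?_ ?_ <;>
      first | fun_prop | (ext i; fin_cases i <;> simp)
  hasPD_conj p := by
    refine (HasPD.vec (.of_deriv ?_ rfl rfl) (.of_deriv ?_ rfl rfl)
      (.of_deriv ?_ rfl rfl)).congr_values ?_ ?_ <;>
      first | fun_prop | (ext i; fin_cases i <;> simp)
  isFrame := by
    refine isFrame_of_mul hasDerivAt_sinh
      (Wu := fun p => ![0, sinh p.1 * sinh p.2, sinh p.1 * cosh p.2])
      (Wt := fun p => ![0, cosh p.1 * cosh p.2, cosh p.1 * sinh p.2])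
      (Tt := fun p => ![0, sinh p.1 * sinh p.2, sinh p.1 * cosh p.2])
      (nu := fun p => ![-sinh p.1, 0, 0])
      (nt := fun p => ![0, -cosh p.2, -sinh p.2])
      ?_ ?_ ?_ ?_ ?_ ?_ ?_ ?_ ?_ ?_ ?_ ?_ ?_ ?_ <;> intro p
    iterate 3
      refine (HasPD.vec (.of_deriv ?_ rfl rfl) (.of_deriv ?_ rfl rfl)
        (.of_deriv ?_ rfl rfl)).congr_values ?_ ?_ <;>
      first | fun_prop | (ext i; fin_cases i <;> simp)
    all_goals have h1 := cosh_sq_sub_sinh_sq p.1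
    all_goals have h2 := cosh_sq_sub_sinh_sq p.2
    iterate 6 simp only [lip, Matrix.cons_val]; grind
    all_goals ext i; fin_cases i <;> simp <;> grind
  revolution := ⟨rotSpacelike, .inr (.inl rfl), fun w => ![w, 0, sinh w],
    contDiff_pi.2 fun i => by fin_cases i <;> simp <;> fun_prop, fun p => by
      ext i
      fin_cases i <;> simp [timelikeHyperbolicCatenoid, rotSpacelike, Matrix.mulVec, dotProduct,
        Fin.sum_univ_three] <;> ring⟩

open Real in
theorem isCatenoid_timelikeParabolic : IsCatenoid (1) (-1) id (fun _ => 1)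
    (fun p => (1 / 2 : ℝ) • timelikeParabolicCatenoid p)
    (fun p => ![-(p.1 ^ 2 * p.2 / 2) + p.2 / 2 - p.2 ^ 3 / 6, -(p.1 ^ 2 / 2) - p.2 ^ 2 / 2, -(p.1 ^ 2 * p.2 / 2) - p.2 / 2 - p.2 ^ 3 / 6])
    (fun p => ![(-p.1 ^ 2 + 1 - p.2 ^ 2) / 2, -p.2, (-p.1 ^ 2 - 1 - p.2 ^ 2) / 2])
    (fun p => ![-(p.1 * p.2), -p.1, -(p.1 * p.2)])
    (fun p => ![(-p.1 ^ 2 - 1 + p.2 ^ 2) / 2, p.2, (-p.1 ^ 2 + 1 + p.2 ^ 2) / 2]) where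
  contDiff := contDiff_pi.2 fun i => by
    fin_cases i <;> simp [timelikeParabolicCatenoid] <;> fun_prop
  contDiff_conj := contDiff_pi.2 fun i => by fin_cases i <;> simp <;> fun_prop
  hasPD p := by
    refine (HasPD.const_smul (1 / 2) (HasPD.vec (.of_deriv ?_ rfl rfl) (.of_deriv ?_ rfl rfl)
      (.of_deriv ?_ rfl rfl))).congr_values ?_ ?_ <;>
      first | fun_prop | (ext i; fin_cases i <;> simp (disch := fun_prop) <;> ring)
  hasPD_conj p := by
    refine (HasPD.vec (.of_deriv ?_ rfl rfl) (.of_deriv ?_ rfl rfl)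
      (.of_deriv ?_ rfl rfl)).congr_values ?_ ?_ <;>
      first | fun_prop | (ext i; fin_cases i <;> simp (disch := fun_prop) <;> ring)
  isFrame := by
    refine isFrame_of_mul hasDerivAt_id
      (Wu := fun p => ![-p.1, 0, -p.1])
      (Wt := fun p => ![-p.2, -1, -p.2])
      (Tt := fun p => ![-p.1, 0, -p.1])
      (nu := fun p => ![-p.1, 0, -p.1])
      (nt := fun p => ![p.2, 1, p.2])
      ?_ ?_ ?_ ?_ ?_ ?_ ?_ ?_ ?_ ?_ ?_ ?_ ?_ ?_ <;> intro p
    iterate 3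
      refine (HasPD.vec (.of_deriv ?_ rfl rfl) (.of_deriv ?_ rfl rfl)
        (.of_deriv ?_ rfl rfl)).congr_values ?_ ?_ <;>
      first | fun_prop | (ext i; fin_cases i <;> simp (disch := fun_prop) <;> ring)
    iterate 6 simp only [lip, Matrix.cons_val]; grind
    all_goals ext i; fin_cases i <;> simp <;> grind
  revolution := ⟨rotLightlike, .inr (.inr rfl), fun w => ![(-(w ^ 3 / 3) + w) / 2, 0, (-(w ^ 3 / 3) - w) / 2],
    contDiff_pi.2 fun i => by fin_cases i <;> simp <;> fun_prop, fun p => by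
      ext i
      fin_cases i <;> simp [timelikeParabolicCatenoid, rotLightlike, Matrix.mulVec, dotProduct,
        Fin.sum_univ_three] <;> ring⟩

open Real in
theorem isCatenoid_timelikeElliptic : IsCatenoid (1) (-1) sin cos
    timelikeEllipticCatenoid
    (fun p => ![cos p.1 * sin p.2, -(cos p.1 * cos p.2), p.2])
    (fun p => ![cos p.1 * cos p.2, cos p.1 * sin p.2, 1])
    (fun p => ![-(sin p.1 * sin p.2), sin p.1 * cos p.2, 0])
    (fun p => ![-cos p.2, -sin p.2, -cos p.1]) where
  contDiff := contDiff_pi.2 fun i => by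
    fin_cases i <;> simp [timelikeEllipticCatenoid] <;> fun_prop
  contDiff_conj := contDiff_pi.2 fun i => by fin_cases i <;> simp <;> fun_prop
  hasPD p := by
    refine (HasPD.vec (.of_deriv ?_ rfl rfl) (.of_deriv ?_ rfl rfl)
      (.of_deriv ?_ rfl rfl)).congr_values ?_ ?_ <;>
      first | fun_prop | (ext i; fin_cases i <;> simp)
  hasPD_conj p := by
    refine (HasPD.vec (.of_deriv ?_ rfl rfl) (.of_deriv ?_ rfl rfl)
      (.of_deriv ?_ rfl rfl)).congr_values ?_ ?_ <;>
      first | fun_prop | (ext i; fin_cases i <;> simp)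
  isFrame := by
    refine isFrame_of_mul hasDerivAt_sin
      (Wu := fun p => ![-(sin p.1 * cos p.2), -(sin p.1 * sin p.2), 0])
      (Wt := fun p => ![-(cos p.1 * sin p.2), cos p.1 * cos p.2, 0])
      (Tt := fun p => ![-(sin p.1 * cos p.2), -(sin p.1 * sin p.2), 0])
      (nu := fun p => ![0, 0, sin p.1])
      (nt := fun p => ![sin p.2, -cos p.2, 0])
      ?_ ?_ ?_ ?_ ?_ ?_ ?_ ?_ ?_ ?_ ?_ ?_ ?_ ?_ <;> intro p
    iterate 3
      refine (HasPD.vec (.of_deriv ?_ rfl rfl) (.of_deriv ?_ rfl rfl)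
        (.of_deriv ?_ rfl rfl)).congr_values ?_ ?_ <;>
      first | fun_prop | (ext i; fin_cases i <;> simp)
    all_goals have h1 := sin_sq_add_cos_sq p.1
    all_goals have h2 := sin_sq_add_cos_sq p.2
    iterate 6 simp only [lip, Matrix.cons_val]; grind
    all_goals ext i; fin_cases i <;> simp <;> grind
  revolution := ⟨rotTimelike, .inl rfl, fun w => ![sin w, 0, w],
    contDiff_pi.2 fun i => by fin_cases i <;> simp <;> fun_prop, fun p => by
      ext i
      fin_cases i <;> simp [timelikeEllipticCatenoid, rotTimelike, Matrix.mulVec, dotProduct,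
        Fin.sum_univ_three] <;> ring⟩

end Catenoids

/-! ### Recognizing the surface as an associate of a catenoid. -/

section Associates

variable {Ω : Set (ℝ × ℝ)} {η δ : ℝ}

/-- The rigidity of frames compares frames over the very same `P` and `Q`. Agreement of the factors
on the open set forces agreement of their derivatives. -/
theorem IsFrame.congr_factor {e f e' f' : ℝ} {P Q P' Q' : ℝ × ℝ → ℝ}
    {U V n U' V' n' : ℝ × ℝ → E} (hΩ : IsOpen Ω) (h : IsFrame η δ e f P Q U V n Ω)
    (h' : IsFrame η δ e' f' P' Q' U' V' n' Ω) (hP : ∀ p ∈ Ω, P p = P' p) :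
    IsFrame η δ e' f' P Q U' V' n' Ω := by
  have hQ : ∀ p ∈ Ω, Q p = Q' p := fun p hp =>
    ((h.hasPD_P p hp).unique ((h'.hasPD_P p hp).congr_on hΩ hp hP)).1
  refine ⟨h.ne_zero, ?_, ?_, ?_, h'.lip_UV, h'.lip_Un, h'.lip_Vn, h.hasPD_P, ?_, ?_, ?_⟩ <;>
    intro p hp <;> try rw [hP p hp]
  · exact h'.lip_UU p hp
  · exact h'.lip_VV p hp
  · exact h'.lip_nn p hp
  all_goals rw [hQ p hp]
  · exact h'.hasPD_U p hp
  · exact h'.hasPD_V p hp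
  · exact h'.hasPD_n p hp

theorem inv_conformal (hη : η = 1 ∨ η = -1) (hδ : δ = 1 ∨ δ = -1) {r : ℝ} (hr : r ≠ 0) :
    (r ^ 2 • !![δ, 0; 0, -(η * δ)] : Matrix (Fin 2) (Fin 2) ℝ)⁻¹ =
      (r ^ 2)⁻¹ • !![δ, 0; 0, -(η * δ)] := by
  refine Matrix.inv_eq_left_inv ?_
  ext i j
  fin_cases i <;> fin_cases j <;> simp [Matrix.mul_apply, Fin.sum_univ_two] <;>
    rcases hη with rfl | rfl <;> rcases hδ with rfl | rfl <;> field_simp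

theorem det_conformal (hδ : δ = 1 ∨ δ = -1) (r : ℝ) :
    (r ^ 2 • !![δ, 0; 0, -(η * δ)] : Matrix (Fin 2) (Fin 2) ℝ).det = -η * r ^ 4 := by
  rcases hδ with rfl | rfl <;> simp [Matrix.det_fin_two] <;> ring

/-- A surface with a frame over a zero mean curvature second fundamental form. -/
theorem IsFrame.meanCurvature_eq_zero {e f : ℝ} {P Q : ℝ × ℝ → ℝ} {U V n : ℝ × ℝ → E}
    {Y : ℝ × ℝ → E} {M : Matrix (Fin 3) (Fin 3) ℝ}
    (hM : ∀ x y : E, lip (M *ᵥ x) (M *ᵥ y) = lip x y) (hη : η = 1 ∨ η = -1)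
    (hδ : δ = 1 ∨ δ = -1) (hΩ : IsOpen Ω) (h : IsFrame η δ e f P Q U V n Ω)
    (hY : ∀ p ∈ Ω, HasPD Y (M *ᵥ U p) (M *ᵥ V p) p) :
    ∀ p ∈ Ω, firstForm Y p = P p ^ 2 • !![δ, 0; 0, -(η * δ)] ∧ meanCurvature Y p = 0 := by
  intro p hp
  have hu : ∀ q ∈ Ω, du Y q = M *ᵥ U q := fun q hq => (hY q hq).fderiv_left
  have hv : ∀ q ∈ Ω, dv Y q = M *ᵥ V q := fun q hq => (hY q hq).fderiv_right
  have hI : firstForm Y p = P p ^ 2 • !![δ, 0; 0, -(η * δ)] := by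
    ext i j
    fin_cases i <;> fin_cases j <;>
      simp [firstForm, hu p hp, hv p hp, hM, h.lip_UU p hp, h.lip_VV p hp, h.lip_UV p hp,
        lip_comm (V p) (U p)] <;> ring
  refine ⟨hI, ?_⟩
  have huu : du (du Y) p = M *ᵥ _ := (((h.hasPD_U p hp).mulVec M).congr_on hΩ hp hu).fderiv_left
  have hvv : dv (dv Y) p = M *ᵥ _ := (((h.hasPD_V p hp).mulVec M).congr_on hΩ hp hv).fderiv_right
  have htr : (weingarten Y p).trace = (P p ^ 2)⁻¹ *
      lip (δ • du (du Y) p + (-(η * δ)) • dv (dv Y) p) (unitNormal Y p) := by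
    rw [weingarten, hI, inv_conformal hη hδ (h.ne_zero p hp), secondForm]
    simp [Matrix.trace_fin_two, lip_add_left, lip_smul_left, lip_neg_left]
    ring
  -- The frame equations give `Y_uu = η Y_vv`, the Laplace or wave equation, so the trace vanishes
  -- whatever the normal is.
  have hz : δ • du (du Y) p + (-(η * δ)) • dv (dv Y) p = 0 := by
    rw [huu, hvv, ← Matrix.mulVec_smul, ← Matrix.mulVec_smul, ← Matrix.mulVec_add]
    convert Matrix.mulVec_zero M using 2
    rcases hη with rfl | rfl <;> module
  rw [meanCurvature, htr, hz]
  simp [lip]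

/-- The catenoid is scaled until its conformal factor is `P`, its frame is turned by `(α, β)`, and
rigidity identifies the result with the frame of `X`. Integrating the coordinate fields leaves one
constant vector. -/
theorem exists_associate {α β m : ℝ} (hη : η = 1 ∨ η = -1) (hδ : δ = 1 ∨ δ = -1)
    (hαβ : α ^ 2 - η * β ^ 2 = 1) (hm : m ≠ 0) (hΩ : IsOpen Ω) (hc : IsConnected Ω)
    {X : ℝ × ℝ → E} {P Q : ℝ × ℝ → ℝ} {U V n : ℝ × ℝ → E}
    (hF : IsFrame η δ (m * α) (m * β) P Q U V n Ω) (hX : ∀ p ∈ Ω, HasPD X (U p) (V p) p)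
    {h h' : ℝ → ℝ} {C Cs W T n' : ℝ × ℝ → E} (hC : IsCatenoid η δ h h' C Cs W T n')
    (hP : HasProfile P m h Ω) :
    ∃ Y Ystar : ℝ × ℝ → E, IsZMCSurface Y Ω ∧
      (∀ p ∈ Ω, firstForm Y p = P p ^ 2 • !![δ, 0; 0, -(η * δ)]) ∧ ContDiffOn ℝ ∞ Ystar Ω ∧
      (∀ p ∈ Ω, du Y p = dv Ystar p ∧ dv Y p = η • du Ystar p) ∧
      (∀ p ∈ Ω, X p = α • Y p + β • Ystar p) ∧
      IsSurfaceOfRevolution Y Ω ∧ IsSimilarPiece Y Ω C := by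
  obtain ⟨σ, k, d, hσ, hk, hP⟩ := hP
  have hm' : 0 < |m| := abs_pos.2 hm
  have hσ2 : σ ^ 2 = 1 := by rcases hσ with rfl | rfl <;> norm_num
  have hσ0 : σ ≠ 0 := by rcases hσ with rfl | rfl <;> norm_num
  have hη2 : η * η = 1 := by rcases hη with rfl | rfl <;> norm_num
  have hm2 : |m| ^ 2 = m ^ 2 := sq_abs m
  obtain ⟨r, hr⟩ : ∃ r, r = |m| / k ^ 2 := ⟨_, rfl⟩
  have hr0 : 0 < r := by rw [hr]; positivity
  -- The ratio `r = |m| / k²` makes `r k` equal to `|s|`. Using `m` instead of `|m|` in `s'` flips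
  -- the normal when `m < 0`, so that the second fundamental form acquires the factor `m` itself.
  -- The profile has no zero here because `P` has none.
  have hS := hC.isFrame.scale (Ω := Ω) (m := m) (r := r) (k := k) (d := d) (s := σ * (|m| / k))
    (s' := σ * (m / k)) (fun p hp h0 => hF.ne_zero p hp (by simp only [hP p hp, h0, mul_zero]))
    (by positivity)
    (by rw [hr]; field_simp; linear_combination hσ2)
    (by rw [hr]; field_simp; rw [hm2]; linear_combination m ^ 2 * hσ2)
    (by rw [hr]; field_simp; rw [hm2])
    (by rw [hr]; field_simp; linear_combination hσ2)
  have hS' := hF.congr_factor hΩ hS hP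
  obtain ⟨M, hM, hMUV⟩ := hF.exists_isometry hη hδ hΩ hc (hS'.rotate hαβ hη)
  have hY₀ : ∀ p, HasPD (fun p => M *ᵥ (r • C (k * p.1 + d, k * p.2)))
      (M *ᵥ ((r * k) • W (k * p.1 + d, k * p.2)))
      (M *ᵥ ((r * k) • T (k * p.1 + d, k * p.2))) p := fun p =>
    (((hC.hasPD _).comp_affine.const_smul r).mulVec M).congr_values
      (by rw [smul_smul]) (by rw [smul_smul])
  have hYs₀ : ∀ p, HasPD (fun p => M *ᵥ (r • Cs (k * p.1 + d, k * p.2)))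
      (η • (M *ᵥ ((r * k) • T (k * p.1 + d, k * p.2))))
      (M *ᵥ ((r * k) • W (k * p.1 + d, k * p.2))) p := fun p =>
    (((hC.hasPD_conj _).comp_affine.const_smul r).mulVec M).congr_values
      (by rw [← Matrix.mulVec_smul]; congr 1; module) (by rw [smul_smul])
  obtain ⟨q, hq⟩ := HasPD.exists_const (f := fun p => X p -
      (α • (M *ᵥ (r • C (k * p.1 + d, k * p.2))) +
        β • (M *ᵥ (r • Cs (k * p.1 + d, k * p.2))))) hΩ hc fun p hp => by
    obtain ⟨h1, h2⟩ := hMUV p hp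
    refine ((hX p hp).sub (((hY₀ p).const_smul α).add ((hYs₀ p).const_smul β))).congr_values
      ?_ ?_
    · rw [← h1, Matrix.mulVec_add, Matrix.mulVec_smul, Matrix.mulVec_smul _ (η * β)]; module
    · rw [← h2, Matrix.mulVec_add, Matrix.mulVec_smul, Matrix.mulVec_smul _ β]; module
  -- The constant `q` is split as `α (α q) + β (-η β q)`, so that translating `Y` and its conjugate
  -- absorbs it.
  have hY : ∀ p, HasPD (fun p => M *ᵥ (r • C (k * p.1 + d, k * p.2)) + α • q)
      (M *ᵥ ((r * k) • W (k * p.1 + d, k * p.2)))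
      (M *ᵥ ((r * k) • T (k * p.1 + d, k * p.2))) p := fun p =>
    ((hY₀ p).add (HasPD.const (α • q) p)).congr_values (add_zero _) (add_zero _)
  have hYs : ∀ p, HasPD (fun p => M *ᵥ (r • Cs (k * p.1 + d, k * p.2)) + (-(η * β)) • q)
      (η • (M *ᵥ ((r * k) • T (k * p.1 + d, k * p.2))))
      (M *ᵥ ((r * k) • W (k * p.1 + d, k * p.2))) p := fun p =>
    ((hYs₀ p).add (HasPD.const ((-(η * β)) • q) p)).congr_values (add_zero _) (add_zero _)
  have hsm : ∀ {D : ℝ × ℝ → E} (z : E), ContDiff ℝ ∞ D →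
      ContDiffOn ℝ ∞ (fun p : ℝ × ℝ => M *ᵥ (r • D (k * p.1 + d, k * p.2)) + z) Ω := by
    intro D z hD
    have h1 : ContDiff ℝ ∞ (fun p : ℝ × ℝ => r • D (k * p.1 + d, k * p.2)) :=
      ContDiff.const_smul r (hD.comp (g := D)
        (f := fun p : ℝ × ℝ => (k * p.1 + d, k * p.2)) (by fun_prop))
    exact (((LinearMap.toContinuousLinearMap M.mulVecLin).contDiff.comp h1).add
      contDiff_const).contDiffOn
  have hgeo := hS'.meanCurvature_eq_zero hM hη hδ hΩ (fun p _ => hY p)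
  have hΦ : IsRigidMotion fun x => M *ᵥ x + α • q := ⟨M, α • q, hM, fun _ => rfl⟩
  refine ⟨_, _, ⟨⟨hsm (α • q) hC.contDiff, fun p hp => ?_⟩, fun p hp => (hgeo p hp).2⟩,
    fun p hp => (hgeo p hp).1, hsm (-(η * β) • q) hC.contDiff_conj, fun p hp => ⟨?_, ?_⟩,
    fun p hp => ?_, ?_, ⟨_, hΦ, r, k, d, hr0, hk, fun p _ => rfl⟩⟩
  · rw [(hgeo p hp).1, det_conformal hδ]
    have h0 := hF.ne_zero p hp
    have : η ≠ 0 := left_ne_zero_of_mul_eq_one hη2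
    exact mul_ne_zero (neg_ne_zero.2 this) (pow_ne_zero 4 h0)
  · exact (hY p).fderiv_left.trans (hYs p).fderiv_right.symm
  · refine (hY p).fderiv_right.trans ?_
    rw [show du _ p = _ from (hYs p).fderiv_left, smul_smul, hη2, one_smul]
  · have h1 := hq p hp
    rw [sub_eq_iff_eq_add] at h1
    rw [h1]
    linear_combination (norm := module) -(hαβ • q)
  · obtain ⟨rot, hrot, γ, hγ, hCγ⟩ := hC.revolution
    refine ⟨_, hΦ, rot, hrot, Set.univ, fun w => r • γ w, fun p => k * p.1 + d, fun p => k * p.2,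
      isOpen_univ, (hγ.const_smul r).contDiffOn, Set.mapsTo_univ _ _,
      ContDiff.contDiffOn (by fun_prop), ContDiff.contDiffOn (by fun_prop), fun p _ => ?_⟩
    simp only [hCγ, Matrix.mulVec_smul]

theorem exists_frame_of_secondForm {α β : ℝ} (hη : η = 1 ∨ η = -1) (hδ : δ = 1 ∨ δ = -1)
    (hαβ : α ^ 2 - η * β ^ 2 = 1) (hΩ : IsOpen Ω) (hc : IsConnected Ω)
    {X : ℝ × ℝ → E} (hX : ContDiffOn ℝ ∞ X Ω) {ρ μ : ℝ → ℝ} (hρ : ∀ p ∈ Ω, 0 < ρ p.1)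
    (hI : ∀ p ∈ Ω, firstForm X p = ρ p.1 ^ 2 • !![δ, 0; 0, -(η * δ)])
    (hII : ∀ p ∈ Ω, secondForm X p = !![μ p.1 * α, μ p.1 * β; μ p.1 * β, η * (μ p.1 * α)])
    (humb : NoOpenUmbilicSet X Ω) :
    ∃ (m C : ℝ) (Q : ℝ × ℝ → ℝ) (U V n : ℝ × ℝ → E), m ≠ 0 ∧
      IsFrame η δ (m * α) (m * β) (fun p => ρ p.1) Q U V n Ω ∧
      (∀ p ∈ Ω, HasPD X (U p) (V p) p) ∧ (∀ p ∈ Ω, HasPD Q (C * ρ p.1) 0 p) ∧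
      ∀ p ∈ Ω, Q p ^ 2 = -(η * δ) * m ^ 2 + C * ρ p.1 ^ 2 := by
  obtain ⟨e, f, Q, Q₁, U, V, n, hF, hXd, hef, hQ, hG⟩ := exists_frame hη hδ hΩ hc hX hρ hI
    (φ := fun u => μ u * α) (ψ := fun u => μ u * β) hII
  -- A single non-umbilic point suffices: the second fundamental form is constant, so `m` may be
  -- taken as the value of `μ` there.
  obtain ⟨p₀, hp₀, hum⟩ := humb Ω hΩ subset_rfl hc.nonempty
  have hm : μ p₀.1 ≠ 0 := by
    intro h0
    refine hum ⟨0, ?_⟩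
    rw [weingarten, hII p₀ hp₀, h0, zero_smul]
    convert Matrix.mul_zero _
    ext i j
    fin_cases i <;> fin_cases j <;> simp
  obtain ⟨h1, h2⟩ := hef p₀ hp₀
  subst h1 h2
  obtain ⟨C, hC1, hC2⟩ := exists_first_integral (κ := -(η * δ) * μ p₀.1 ^ 2) hΩ hc hF.ne_zero
    hF.hasPD_P hQ fun p hp => by
      rw [hG p hp]; linear_combination η * δ * μ p₀.1 ^ 2 * hαβ
  exact ⟨μ p₀.1, C, Q, U, V, n, hm, hF, hXd, hC1, hC2⟩

theorem IsSimilarPiece.of_smul {Y C : ℝ × ℝ → E} {a : ℝ} (ha : 0 < a)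
    (h : IsSimilarPiece Y Ω fun p => a • C p) : IsSimilarPiece Y Ω C := by
  obtain ⟨Φ, hΦ, r, k, d, hr, hk, hY⟩ := h
  exact ⟨Φ, hΦ, r * a, k, d, mul_pos hr ha, hk, fun p hp => by rw [hY p hp, smul_smul]⟩

theorem trace_weingarten_eq_zero {X : ℝ × ℝ → E} (hX : IsZMCSurface X Ω) {p : ℝ × ℝ}
    (hp : p ∈ Ω) : (weingarten X p).trace = 0 := by
  have h := hX.2 p hp
  have hs : Real.sign (firstForm X p).det ≠ 0 := by
    simpa [Real.sign_eq_zero_iff] using hX.1.2 p hp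
  rw [meanCurvature] at h
  simpa [hs] using h

theorem secondForm_eq_mul {X : ℝ × ℝ → E} (hX : IsZMCSurface X Ω) {p : ℝ × ℝ}
    (hp : p ∈ Ω) : secondForm X p = firstForm X p * weingarten X p := by
  rw [weingarten, Matrix.mul_nonsing_inv_cancel_left _ _ (hX.1.2 p hp).isUnit]

theorem exists_spacelike_associate {X : ℝ × ℝ → E} {δ ε c : ℝ} (hΩ : IsOpen Ω)
    (hc : IsConnected Ω) (hX : IsZMCSurface X Ω) (hrot : IsIntrinsicRotational X Ω δ ε)
    (htwist : HasTwist X Ω fun _ => c) (humb : NoOpenUmbilicSet X Ω) (hsp : IsSpacelike X Ω) :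
    ∃ (Y : ℝ × ℝ → E) (θ : ℝ), IsSpacelikeAssociate X Y Ω θ ∧ IsSurfaceOfRevolution Y Ω ∧
      (IsSimilarPiece Y Ω ellipticCatenoid ∨ IsSimilarPiece Y Ω parabolicCatenoid ∨
        IsSimilarPiece Y Ω hyperbolicCatenoid) := by
  obtain ⟨p₀, hp₀⟩ := hc.nonempty
  obtain ⟨hδ, hε, ρ, hρ⟩ := hrot
  have hδ1 : δ = 1 := by
    have h := (hsp p₀ hp₀).diag_pos (i := 0)
    have h0 := (hρ p₀ hp₀).1
    rw [(hρ p₀ hp₀).2] at h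
    rcases hδ with h1 | rfl
    · exact h1
    · simp at h; nlinarith [sq_nonneg (ρ p₀.1)]
  have hε1 : ε = 1 := by
    have h := (hsp p₀ hp₀).diag_pos (i := 1)
    have h0 := (hρ p₀ hp₀).1
    rw [(hρ p₀ hp₀).2] at h
    rcases hε with h1 | rfl
    · exact h1
    · simp at h; nlinarith [sq_nonneg (ρ p₀.1)]
  subst hδ1 hε1
  obtain ⟨-, l₁, l₂, ⟨-, hW⟩ | ⟨htl, -⟩⟩ := htwist
  swap
  · exact absurd (htl p₀ hp₀) (hsp p₀ hp₀).det_pos.not_gt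
  have hl : ∀ p ∈ Ω, l₂ p.1 = -l₁ p.1 := fun p hp => by
    have h := trace_weingarten_eq_zero hX hp
    rw [hW p hp] at h
    simp [R, Matrix.trace_fin_two] at h
    linear_combination h - (l₁ p.1 + l₂ p.1) * Real.sin_sq_add_cos_sq c
  have hη : (-1 : ℝ) = 1 ∨ (-1 : ℝ) = -1 := .inr rfl
  have hI : ∀ p ∈ Ω, firstForm X p = ρ p.1 ^ 2 • !![1, 0; 0, -(-1 * 1)] := fun p hp => by
    rw [(hρ p hp).2]; norm_num
  -- Conjugating `diag(l, -l)` by `R c` gives diagonal entries `±l cos 2c` and off-diagonal entries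
  -- `-l sin 2c`, whence `θ = -2c`.
  have hαβ : Real.cos (-2 * c) ^ 2 - -1 * Real.sin (-2 * c) ^ 2 = 1 := by
    linear_combination Real.sin_sq_add_cos_sq (-2 * c)
  obtain ⟨m, C, Q, U, V, n, hm, hF, hXd, hQ, hC⟩ := exists_frame_of_secondForm hη (.inl rfl) hαβ
    hΩ hc hX.1.1 (μ := fun u => ρ u ^ 2 * l₁ u) (fun p hp => (hρ p hp).1) hI (fun p hp => by
      rw [secondForm_eq_mul hX hp, (hρ p hp).2, hW p hp, hl p hp, neg_mul, Real.cos_neg,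
        Real.sin_neg, Real.cos_two_mul', Real.sin_two_mul]
      ext i j
      fin_cases i <;> fin_cases j <;> simp [R, Matrix.mul_apply, Fin.sum_univ_two] <;> ring)
    humb
  have fin : ∀ {h h' : ℝ → ℝ} {D Ds W T n' : ℝ × ℝ → E}, IsCatenoid (-1) 1 h h' D Ds W T n' →
      HasProfile (fun p => ρ p.1) m h Ω → ∃ (Y : ℝ × ℝ → E) (θ : ℝ),
        IsSpacelikeAssociate X Y Ω θ ∧ IsSurfaceOfRevolution Y Ω ∧ IsSimilarPiece Y Ω D := by
    intro h h' D Ds W T n' hD hP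
    obtain ⟨Y, Ys, h1, h2, h3, h4, h5, h6, h7⟩ :=
      exists_associate hη (.inl rfl) hαβ hm hΩ hc hF hXd hD hP
    refine ⟨Y, -2 * c, ⟨h1, fun p hp => ?_, fun p hp => ⟨ρ p.1 ^ 2, ?_⟩, Ys, h3, fun p hp => ?_, h5⟩,
      h6, h7⟩
    · have := hsp p hp
      rwa [hI p hp, ← h2 p hp] at this
    · rw [h2 p hp]; norm_num
    · simpa using h4 p hp
  rcases hasProfile_of_elliptic hm hΩ hc hF.hasPD_P hQ (fun p hp => by rw [hC p hp]; ring) with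
    h | h | h
  · obtain ⟨Y, θ, h1, h2, h3⟩ := fin isCatenoid_elliptic h
    exact ⟨Y, θ, h1, h2, .inl h3⟩
  · obtain ⟨Y, θ, h1, h2, h3⟩ := fin isCatenoid_parabolic h
    exact ⟨Y, θ, h1, h2, .inr (.inl (h3.of_smul (by norm_num)))⟩
  · obtain ⟨Y, θ, h1, h2, h3⟩ := fin isCatenoid_hyperbolic h
    exact ⟨Y, θ, h1, h2, .inr (.inr h3)⟩

theorem exists_timelike_associate {X : ℝ × ℝ → E} {δ ε c : ℝ} (hΩ : IsOpen Ω)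
    (hc : IsConnected Ω) (hX : IsZMCSurface X Ω) (hrot : IsIntrinsicRotational X Ω δ ε)
    (htwist : HasTwist X Ω fun _ => c) (humb : NoOpenUmbilicSet X Ω) (htl : IsTimelike X Ω) :
    ∃ (Y : ℝ × ℝ → E) (θ : ℝ), IsTimelikeAssociate X Y Ω θ ∧ IsSurfaceOfRevolution Y Ω ∧
      (δ = 1 → IsSimilarPiece Y Ω timelikeCatenoid) ∧
      (δ = -1 → IsSimilarPiece Y Ω timelikeHyperbolicCatenoid ∨
        IsSimilarPiece Y Ω timelikeParabolicCatenoid ∨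
        IsSimilarPiece Y Ω timelikeEllipticCatenoid) := by
  obtain ⟨p₀, hp₀⟩ := hc.nonempty
  obtain ⟨hδ, hε, ρ, hρ⟩ := hrot
  -- A negative determinant forces opposite signs in the metric, which is the common form with `η =
  -- 1`.
  have hε1 : ε = -(1 * δ) := by
    have h := htl p₀ hp₀
    have h0 := (hρ p₀ hp₀).1
    rw [(hρ p₀ hp₀).2] at h
    rcases hδ with rfl | rfl <;> rcases hε with rfl | rfl <;>
      simp [Matrix.det_fin_two] at h ⊢ <;> nlinarith [pow_pos h0 4]
  subst hε1
  obtain ⟨-, l₁, l₂, ⟨hsp, -⟩ | ⟨-, hW⟩⟩ := htwist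
  · exact absurd (htl p₀ hp₀) (hsp p₀ hp₀).det_pos.not_gt
  have hl : ∀ p ∈ Ω, l₂ p.1 = -l₁ p.1 := fun p hp => by
    have h := trace_weingarten_eq_zero hX hp
    rw [hW p hp] at h
    simp [G, Matrix.trace_fin_two] at h
    linear_combination h - (l₁ p.1 + l₂ p.1) * Real.cosh_sq_sub_sinh_sq c
  have hη : (1 : ℝ) = 1 ∨ (1 : ℝ) = -1 := .inl rfl
  have hαβ : Real.cosh (2 * c) ^ 2 - 1 * Real.sinh (2 * c) ^ 2 = 1 := by
    linear_combination Real.cosh_sq_sub_sinh_sq (2 * c)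
  -- Lowering an index with `ρ² diag(δ, -δ)` makes the conjugate of `diag(l, -l)` by `G c`
  -- symmetric, and puts the factor `δ` into `μ`; here `θ = 2c`.
  obtain ⟨m, C, Q, U, V, n, hm, hF, hXd, hQ, hC⟩ := exists_frame_of_secondForm hη hδ hαβ
    hΩ hc hX.1.1 (μ := fun u => ρ u ^ 2 * δ * l₁ u) (fun p hp => (hρ p hp).1)
    (fun p hp => (hρ p hp).2) (fun p hp => by
      rw [secondForm_eq_mul hX hp, (hρ p hp).2, hW p hp, hl p hp, Real.cosh_two_mul,
        Real.sinh_two_mul]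
      ext i j
      fin_cases i <;> fin_cases j <;> simp [G, Matrix.mul_apply, Fin.sum_univ_two] <;> ring)
    humb
  have fin : ∀ {h h' : ℝ → ℝ} {D Ds W T n' : ℝ × ℝ → E}, IsCatenoid 1 δ h h' D Ds W T n' →
      HasProfile (fun p => ρ p.1) m h Ω → ∃ (Y : ℝ × ℝ → E) (θ : ℝ),
        IsTimelikeAssociate X Y Ω θ ∧ IsSurfaceOfRevolution Y Ω ∧ IsSimilarPiece Y Ω D := by
    intro h h' D Ds W T n' hD hP
    obtain ⟨Y, Ys, h1, h2, h3, h4, h5, h6, h7⟩ :=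
      exists_associate hη hδ hαβ hm hΩ hc hF hXd hD hP
    refine ⟨Y, 2 * c, ⟨h1, fun p hp => ?_, fun p hp => ⟨ρ p.1 ^ 2 * δ, ?_⟩, Ys, h3,
      fun p hp => ?_, h5⟩, h6, h7⟩
    · have := htl p hp
      rwa [(hρ p hp).2, ← h2 p hp] at this
    · rw [h2 p hp]
      ext i j
      fin_cases i <;> fin_cases j <;> simp
    · simpa using h4 p hp
  rcases hδ with rfl | rfl
  · obtain ⟨Y, θ, h1, h2, h3⟩ := fin isCatenoid_timelike
      (hasProfile_cosh hm hΩ hc hF.hasPD_P hQ (fun p hp => by rw [hC p hp]; ring))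
    exact ⟨Y, θ, h1, h2, fun _ => h3, fun h => by norm_num at h⟩
  · rcases hasProfile_of_elliptic hm hΩ hc hF.hasPD_P hQ (fun p hp => by rw [hC p hp]; ring) with
      h | h | h
    · obtain ⟨Y, θ, h1, h2, h3⟩ := fin isCatenoid_timelikeHyperbolic h
      exact ⟨Y, θ, h1, h2, fun h => by norm_num at h, fun _ => .inl h3⟩
    · obtain ⟨Y, θ, h1, h2, h3⟩ := fin isCatenoid_timelikeParabolic h
      exact ⟨Y, θ, h1, h2, fun h => by norm_num at h,
        fun _ => .inr (.inl (h3.of_smul (by norm_num)))⟩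
    · obtain ⟨Y, θ, h1, h2, h3⟩ := fin isCatenoid_timelikeElliptic h
      exact ⟨Y, θ, h1, h2, fun h => by norm_num at h, fun _ => .inr (.inr h3)⟩

end Associates

end Minkowski3

theorem mainTheorem5
    (Ω : Set (ℝ × ℝ)) (hΩ : IsOpen Ω) (hΩc : IsConnected Ω)
    (X : ℝ × ℝ → Minkowski3.E) (δ ε c : ℝ)
    (hX : Minkowski3.IsZMCSurface X Ω)
    (hrot : Minkowski3.IsIntrinsicRotational X Ω δ ε)
    (htwist : Minkowski3.HasTwist X Ω (fun _ => c))
    (humb : Minkowski3.NoOpenUmbilicSet X Ω) :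
    (Minkowski3.IsSpacelike X Ω →
      ∃ (Y : ℝ × ℝ → Minkowski3.E) (θ : ℝ),
        Minkowski3.IsSpacelikeAssociate X Y Ω θ ∧
        Minkowski3.IsSurfaceOfRevolution Y Ω ∧
        (Minkowski3.IsSimilarPiece Y Ω Minkowski3.ellipticCatenoid ∨
          Minkowski3.IsSimilarPiece Y Ω Minkowski3.parabolicCatenoid ∨
          Minkowski3.IsSimilarPiece Y Ω Minkowski3.hyperbolicCatenoid)) ∧
    (Minkowski3.IsTimelike X Ω →
      ∃ (Y : ℝ × ℝ → Minkowski3.E) (θ : ℝ),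
        Minkowski3.IsTimelikeAssociate X Y Ω θ ∧
        Minkowski3.IsSurfaceOfRevolution Y Ω ∧
        (δ = 1 → Minkowski3.IsSimilarPiece Y Ω Minkowski3.timelikeCatenoid) ∧
        (δ = -1 →
          Minkowski3.IsSimilarPiece Y Ω Minkowski3.timelikeHyperbolicCatenoid ∨
          Minkowski3.IsSimilarPiece Y Ω Minkowski3.timelikeParabolicCatenoid ∨
          Minkowski3.IsSimilarPiece Y Ω Minkowski3.timelikeEllipticCatenoid)) := by
  exact ⟨Minkowski3.exists_spacelike_associate hΩ hΩc hX hrot htwist humb,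
    Minkowski3.exists_timelike_associate hΩ hΩc hX hrot htwist humb⟩
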